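/- A binary CSP instance consists of a finite set $V$ of variables, a finite domain $D$, and constraints, at most one on each scope: unary relations on single variables and binary relations on pairs of distinct variables, each given explicitly by the set of its allowed tuples (an absent constraint allows every tuple). A solution is a map $s:V\to D$ satisfying all constraints. Say that $\mathrm{Pivot}(1)$ occurs in an instance if there are four pairwise distinct variables $p,v,w,x$ and values $\alpha,\beta,\gamma,\delta,\varepsilon\in D$ (with $\alpha=\beta$ permitted) such that the binary constraints disallow the three pairs of assignments $(\langle p,\alpha\rangle,\langle v,\gamma\rangle)$, $(\langle p,\alpha\rangle,\langle w,\delta\rangle)$ and $(\langle p,\beta\rangle,\langle x,\varepsilon\rangle)$. Let $\mathrm{CSP}(\overline{\mathrm{Pivot}(1)})$ be the class of binary CSP instances in which $\mathrm{Pivot}(1)$ does not occur. **Proposition.** $\mathrm{CSP}(\overline{\mathrm{Pivot}(1)})$ can be solved in polynomial time: there is a deterministic Turing machine that, given any instance of this class, outputs a solution of it, or reports that none exists, in a number of steps that is polynomial in the length of the encoding of the instance. Moreover, the class contains instances of unbounded tree width: for every $k$ there is an instance in $\mathrm{CSP}(\overline{\mathrm{Pivot}(1)})$ whose constraint graph (the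 graph on $V$ whose edges are the pairs $\{u,v\}$ carrying a binary constraint that disallows at least one tuple) has tree width greater than $k$. -/

import Mathlib

/-- Truth values of the three-valued logic: true, false, unknown. -/
inductive TV : Type
  | T
  | F
  | U

/-- `U` lies below `T` and `F`, which are incomparable. -/
instance TV.instPartialOrder : PartialOrder TV where
  le x y := x = TV.U ∨ x = y
  le_refl _ := Or.inr rfl
  le_trans x y z hxy hyz := by
    rcases hxy with rfl | rfl
    · exact Or.inl rfl
    · exact hyz
  le_antisymm x y hxy hyx := by
    rcases hxy with rfl | rfl
    · rcases hyx with rfl | h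
      · rfl
      · exact h.symm
    · rfl

/-- The two-valued truth values inside the three-valued logic. -/
def TV.ofBool : Bool → TV
  | true => TV.T
  | false => TV.F

/-- A constraint pattern in functional representation: a scope `σ ⊆ V` and a three-valued
relation `D^σ → {T, F, U}`. -/
structure ConstraintPattern (V D : Type) where
  scope : Set V
  rel : (scope → D) → TV

/-- A CSP pattern on the variable set `V` and the domain `D`: a set of constraint patterns
together with a context, that is, a relational structure on `V × D`. -/
structure CSPPattern (V D : Type) where
  constraints : Set (ConstraintPattern V D)
  ctx : V × D → V × D → Prop

/-- The context used for flat patterns all of whose variables are declared to be distinct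
(`NEQ`): it only tells distinct variables apart. -/
def neqContext (V D : Type) : V × D → V × D → Prop := fun x y => x.1 ≠ y.1

/-- `c` realises `c'`: the scopes are equal, and `c` is pointwise at least `c'`. -/
def ConstraintPattern.Realises {V D : Type} (c c' : ConstraintPattern V D) : Prop :=
  ∃ h : c.scope = c'.scope, ∀ f : c.scope → D,
    c'.rel (fun v => f ⟨v.1, h.symm ▸ v.2⟩) ≤ c.rel f

/-- The labelling `ℓ` of `σ` is mapped to the labelling `f` of `s(σ)` when variables are renamed
by `s` and values are renamed by `t`. -/
def LabellingMapsTo {V D V' D' : Type} (s : V → V') (t : V → D → D') {σ : Set V}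
    (l : σ → D) (f : (s '' σ) → D') : Prop :=
  ∀ v : σ, f ⟨s v.1, Set.mem_image_of_mem s v.2⟩ = t v.1 (l v)

open Classical in
/-- The image of a constraint pattern under a renaming: each labelling of `s(σ)` receives the
maximum of the truth values of its preimages, and `U` if there are none. -/
noncomputable def ConstraintPattern.rename {V D V' D' : Type} (s : V → V') (t : V → D → D')
    (c : ConstraintPattern V D) : ConstraintPattern V' D' where
  scope := s '' c.scope
  rel f :=
    if ∃ l, LabellingMapsTo s t l f ∧ c.rel l = TV.T then TV.T
    else if ∃ l, LabellingMapsTo s t l f ∧ c.rel l = TV.F then TV.F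
    else TV.U

/-- The variable renaming `s` and the domain renaming `t` define a renaming of `χ` into patterns
with context `ω'`. -/
structure IsRenaming {V D V' D' : Type} (χ : CSPPattern V D) (ω' : V' × D' → V' × D' → Prop)
    (s : V → V') (t : V → D → D') : Prop where
  /-- Variables of a common constraint pattern that is not identically `U` are not merged. -/
  not_merged : ∀ v₁ v₂, v₁ ≠ v₂ → s v₁ = s v₂ →
    ¬ ∃ c ∈ χ.constraints, v₁ ∈ c.scope ∧ v₂ ∈ c.scope ∧ ∃ l, c.rel l ≠ TV.U
  /-- The map `⟨v, a⟩ ↦ ⟨s v, t v a⟩` preserves the context. -/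
  contextual : ∀ x y, χ.ctx x y → ω' (s x.1, t x.1 x.2) (s y.1, t y.1 y.2)
  /-- Labellings with the same image have comparable truth values. -/
  comparable : ∀ c ∈ χ.constraints, ∀ l l' : c.scope → D,
    (∀ v : c.scope, t v.1 (l v) = t v.1 (l' v)) → c.rel l ≤ c.rel l' ∨ c.rel l' ≤ c.rel l

/-- The pattern `χ` occurs in the pattern `P`: every constraint pattern of some renaming of `χ`
is realised by a constraint pattern of `P`. -/
def CSPPattern.OccursIn {V D V' D' : Type} (χ : CSPPattern V D) (P : CSPPattern V' D') : Prop :=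
  ∃ (s : V → V') (t : V → D → D'), IsRenaming χ P.ctx s t ∧
    ∀ c ∈ χ.constraints, ∃ c' ∈ P.constraints, c'.Realises (c.rename s t)

/-- A solution satisfies every constraint. -/
def CSPPattern.IsSolution {V D : Type} (P : CSPPattern V D) (s : V → D) : Prop :=
  ∀ c ∈ P.constraints, c.rel (fun v => s v.1) = TV.T

/-- The constraint graph: the edges are the binary scopes whose relation is not complete. -/
def CSPPattern.constraintGraph {V D : Type} (P : CSPPattern V D) : SimpleGraph V where
  Adj u v := u ≠ v ∧ ∃ c ∈ P.constraints, c.scope = {u, v} ∧ ∃ l, c.rel l ≠ TV.T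
  symm := ⟨fun u v h => ⟨h.1.symm, by rw [Set.pair_comm]; exact h.2⟩⟩
  loopless := ⟨fun _ h => h.1 rfl⟩

/-! ### Pivot patterns -/

open Classical in
/-- The constraint pattern `{(⟨u, α⟩, ⟨v, β⟩)} ↦ F` with scope `{u, v}`; all other labellings
are undefined. -/
noncomputable def nogood {V D : Type} (u : V) (α : D) (v : V) (β : D) :
    ConstraintPattern V D where
  scope := {u, v}
  rel l := if l ⟨u, by simp⟩ = α ∧ l ⟨v, by simp⟩ = β then TV.F else TV.U

/-- The variables of the pivot pattern with three branches of length `r`. -/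
inductive PivotVar (r : ℕ) : Type
  | p
  | v (i : Fin r)
  | w (i : Fin r)
  | x (i : Fin r)

/-- The domain of the pivot patterns. -/
inductive PivotVal : Type
  | a
  | b

open PivotVar PivotVal in
/-- The pattern `Pivot(r)`, with pairwise distinct variables. The indices `1, …, r` are
represented by `0, …, r - 1`. -/
def Pivot (r : ℕ) : CSPPattern (PivotVar r) PivotVal where
  constraints := {c |
    (∃ i : Fin r, i.val = 0 ∧
      (c = nogood p a (v i) b ∨ c = nogood p a (w i) b ∨ c = nogood p b (x i) b)) ∨
    (∃ i j : Fin r, i.val + 1 = j.val ∧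
      (c = nogood (v i) a (v j) b ∨ c = nogood (w i) a (w j) b ∨ c = nogood (x i) a (x j) b))}
  ctx := neqContext _ _

/-! ### Binary CSP instances -/

/-- A binary CSP instance with variables `0, …, n - 1` and domain `{0, …, d - 1}`: one unary
constraint on each variable and one binary constraint on each pair of distinct variables, given
by the tables of their relations (`true` means allowed). An absent constraint is a complete one. -/
structure BinaryCSP : Type where
  n : ℕ
  d : ℕ
  unary : Fin n → Fin d → Bool
  binary : (u v : Fin n) → u < v → Fin d → Fin d → Bool

namespace BinaryCSP

/-- The unary constraint on `v`, in functional representation. -/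
def unaryConstraint (P : BinaryCSP) (v : Fin P.n) : ConstraintPattern (Fin P.n) (Fin P.d) where
  scope := {v}
  rel l := TV.ofBool (P.unary v (l ⟨v, by simp⟩))

/-- The binary constraint on `{u, v}`, in functional representation. -/
def binaryConstraint (P : BinaryCSP) (u v : Fin P.n) (h : u < v) :
    ConstraintPattern (Fin P.n) (Fin P.d) where
  scope := {u, v}
  rel l := TV.ofBool (P.binary u v h (l ⟨u, by simp⟩) (l ⟨v, by simp⟩))

/-- An instance is a pattern without the value `U`, in the flat context. -/
def toPattern (P : BinaryCSP) : CSPPattern (Fin P.n) (Fin P.d) where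
  constraints := {c | (∃ v, c = P.unaryConstraint v) ∨ ∃ u v h, c = P.binaryConstraint u v h}
  ctx := neqContext _ _

/-- The input string of an instance: `n` and `d` in unary notation, followed by the tables of the
unary constraints and of the binary constraints. -/
def encode (P : BinaryCSP) : List Bool :=
  List.replicate P.n true ++ [false] ++ List.replicate P.d true ++ [false] ++
  ((List.finRange P.n).flatMap fun v => (List.finRange P.d).map fun a => P.unary v a) ++
  ((List.finRange P.n).flatMap fun u => (List.finRange P.n).flatMap fun v =>
    if h : u < v then
      (List.finRange P.d).flatMap fun a => (List.finRange P.d).map fun b => P.binary u v h a b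
    else [])

end BinaryCSP

/-- The class of binary CSP instances in which the pattern `χ` does not occur. -/
def cspForbidding {V D : Type} (χ : CSPPattern V D) : Set BinaryCSP :=
  {P | ¬ χ.OccursIn P.toPattern}

/-- The output string: `0` if there is no solution; otherwise `1` followed by the values of the
solution in unary notation, each one closed by `0`. -/
def encodeAnswer : Option (List ℕ) → List Bool
  | none => [false]
  | some l => true :: l.flatMap fun a => List.replicate a true ++ [false]

/-- Some deterministic Turing machine (with several stacks), run on the instances of the class
`𝒞`, finds a solution or reports that there is none, in time polynomial in the length of the
input string. -/
def SolvableInPolyTime (𝒞 : Set BinaryCSP) : Prop :=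
  ∃ solve : 𝒞 → Option (List ℕ),
    Nonempty (Turing.TM2ComputableInPolyTime (fun P : 𝒞 => P.1.encode) encodeAnswer solve) ∧
    ∀ P : 𝒞,
      (∀ l, solve P = some l →
        ∃ s, P.1.toPattern.IsSolution s ∧ l = List.ofFn fun v => (s v : ℕ)) ∧
      (solve P = none → ¬ ∃ s, P.1.toPattern.IsSolution s)

/-! ### Tree width -/

/-- A tree decomposition of the graph `G`. -/
structure TreeDecomposition {V : Type} (G : SimpleGraph V) where
  Node : Type
  [fintypeNode : Fintype Node]
  tree : SimpleGraph Node
  isTree : tree.IsTree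
  bag : Node → Finset V
  connected : ∀ v, (tree.induce {t | v ∈ bag t}).Connected
  edge_subset : ∀ u v, G.Adj u v → ∃ t, u ∈ bag t ∧ v ∈ bag t

/-- The width of a tree decomposition: the largest size of a bag, minus one. -/
def TreeDecomposition.width {V : Type} {G : SimpleGraph V} (X : TreeDecomposition G) : ℕ :=
  letI := X.fintypeNode
  (Finset.univ.sup fun t => (X.bag t).card) - 1

/-- The tree width of a graph: the smallest width of a tree decomposition. -/
noncomputable def treeWidth {V : Type} (G : SimpleGraph V) : ℕ :=
  sInf (Set.range fun X : TreeDecomposition G => X.width)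

open Function Turing

/-- Structured programs acting on stacks of bits; `loop k P` runs `P` as many times as the stack
`k` has elements at the start of the loop. -/
inductive StackProg (K : Type) : Type
  | skip
  | push (k : K) (b : Bool)
  | pop (k : K)
  | ite (k : K) (P Q : StackProg K)
  | seq (P Q : StackProg K)
  | loop (k : K) (P : StackProg K)

namespace StackProg

infixr:60 " ;; " => StackProg.seq

variable {K : Type}

/-- `Runs B P s s'`: the program `P` transforms the stacks `s` into `s'`, and every loop that is
executed has at most `B` iterations. -/
inductive Runs [DecidableEq K] (B : ℕ) :
    StackProg K → (K → List Bool) → (K → List Bool) → Prop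
  | skip (s) : Runs B skip s s
  | push (s) (k : K) (b : Bool) : Runs B (push k b) s (update s k (b :: s k))
  | pop (s) (k : K) : Runs B (pop k) s (update s k (s k).tail)
  | iteTrue {s s' : K → List Bool} {k : K} {P : StackProg K} (Q : StackProg K) :
      (s k).head? = some true → Runs B P s s' → Runs B (ite k P Q) s s'
  | iteFalse {s s' : K → List Bool} {k : K} (P : StackProg K) {Q : StackProg K} :
      (s k).head? ≠ some true → Runs B Q s s' → Runs B (ite k P Q) s s'
  | seq {s s' s'' : K → List Bool} {P Q : StackProg K} :
      Runs B P s s' → Runs B Q s' s'' → Runs B (seq P Q) s s''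
  | loop (σ : ℕ → K → List Bool) {k : K} {P : StackProg K} {N : ℕ} : (σ 0 k).length = N → N ≤ B →
      (∀ i < N, Runs B P (σ i) (σ (i + 1))) → Runs B (loop k P) (σ 0) (σ N)

/-- The labels of the Turing machine that executes a program. -/
def Lbl : StackProg K → Type
  | skip | push _ _ | pop _ => Unit
  | ite _ P Q => Option (Lbl P ⊕ Lbl Q)
  | seq P Q => Lbl P ⊕ Lbl Q
  | loop _ P => Lbl P ⊕ Fin 3

instance Lbl.instFintype : (P : StackProg K) → Fintype (Lbl P)
  | skip | push _ _ | pop _ => inferInstanceAs (Fintype Unit)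
  | ite _ P Q =>
    letI := instFintype P
    letI := instFintype Q
    inferInstanceAs (Fintype (Option (Lbl P ⊕ Lbl Q)))
  | seq P Q =>
    letI := instFintype P
    letI := instFintype Q
    inferInstanceAs (Fintype (Lbl P ⊕ Lbl Q))
  | loop _ P =>
    letI := instFintype P
    inferInstanceAs (Fintype (Lbl P ⊕ Fin 3))

/-- The label at which the execution of a program starts. -/
def entry : (P : StackProg K) → Lbl P
  | skip | push _ _ | pop _ => ()
  | ite _ _ _ => (none : Option _)
  | seq P _ => Sum.inl (entry P)
  | loop _ _ => Sum.inr 0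

/-- The nesting depth of loops. -/
def depth : StackProg K → ℕ
  | skip | push _ _ | pop _ => 0
  | ite _ P Q | seq P Q => max (depth P) (depth Q)
  | loop _ P => depth P + 1

/-- A bound for the running time of a program in terms of a bound for the lengths of its loops. -/
noncomputable def cost : StackProg K → Polynomial ℕ
  | skip | push _ _ | pop _ => 1
  | ite _ P Q => 1 + (cost P + cost Q)
  | seq P Q => cost P + cost Q
  | loop _ P => Polynomial.X * (cost P + 3) + 3

/-- The stack that counts the iterations of a loop of nesting level `i`. -/
def counter (K : Type) (D i : ℕ) : K ⊕ Fin (D + 1) := Sum.inr (Fin.ofNat (D + 1) i)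

section

variable {Λ : Type} {D : ℕ}

local notation "MStmt" => TM2.Stmt (fun _ : K ⊕ Fin (D + 1) => Bool) Λ (Option Bool)

/-- Pop the stack `k`, and continue with `P` applied to the popped bit, or with `Q` if the stack is
empty. -/
def popCases (k : K ⊕ Fin (D + 1)) (P : MStmt → MStmt) (l₁ l₂ : Λ) : MStmt :=
  .pop k (fun _ o => o) (.branch Option.isSome
    (P (.load (fun _ => none) (.goto fun _ => l₁))) (.goto fun _ => l₂))

/-- The statements of the Turing machine that executes a program, where the labels of the program
are embedded by `e` into those of the machine, the machine continues at the label `x` afterwards,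
and `i` is the level of nesting. -/
def code : (P : StackProg K) → ℕ → (Lbl P → Λ) → Λ → Lbl P → MStmt
  | skip, _, _, x, _ => .goto fun _ => x
  | push k b, _, _, x, _ => .push (.inl k) (fun _ => b) (.goto fun _ => x)
  | pop k, _, _, x, _ => .pop (.inl k) (fun v _ => v) (.goto fun _ => x)
  | ite k P Q, i, e, x, l =>
    match (l : Option (Lbl P ⊕ Lbl Q)) with
    | none => .peek (.inl k) (fun _ o => o) (.branch (fun o => o == some true)
        (.load (fun _ => none) (.goto fun _ => e (some (.inl (entry P)))))
        (.load (fun _ => none) (.goto fun _ => e (some (.inr (entry Q))))))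
    | some (.inl l) => code P i (fun l => e (some (.inl l))) x l
    | some (.inr l) => code Q i (fun l => e (some (.inr l))) x l
  | seq P Q, i, e, x, l =>
    match (l : Lbl P ⊕ Lbl Q) with
    | .inl l => code P i (fun l => e (.inl l)) (e (.inr (entry Q))) l
    | .inr l => code Q i (fun l => e (.inr l)) x l
  | loop k P, i, e, x, l =>
    match (l : Lbl P ⊕ Fin 3) with
    | .inl l => code P (i + 1) (fun l => e (.inl l)) (e (.inr 2)) l
    | .inr 0 => popCases (.inl k)
        (fun q => .push (counter K D (i + 1)) (fun o => o.getD false) q) (e (.inr 0)) (e (.inr 1))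
    | .inr 1 => popCases (counter K D (i + 1))
        (fun q => .push (.inl k) (fun o => o.getD false)
          (.push (counter K D i) (fun _ => true) q)) (e (.inr 1)) (e (.inr 2))
    | .inr 2 => popCases (counter K D i) (fun q => q) (e (.inl (entry P))) x

end

/-- `f` leads from `a` to `b` in at most `t` steps. -/
def Within {α : Type} (f : α → Option α) (a b : α) (t : ℕ) : Prop :=
  ∃ n ≤ t, (flip bind f)^[n] (some a) = some b

section Within

variable {α : Type} {f : α → Option α} {a b c : α} {t t' : ℕ}

lemma Within.refl (a : α) : Within f a a 0 := ⟨0, le_rfl, rfl⟩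

lemma Within.single (h : f a = some b) : Within f a b 1 := ⟨1, le_rfl, h⟩

lemma Within.trans (h : Within f a b t) (h' : Within f b c t') : Within f a c (t + t') := by
  obtain ⟨n, hn, h⟩ := h
  obtain ⟨n', hn', h'⟩ := h'
  refine ⟨n' + n, by omega, ?_⟩
  rw [Function.iterate_add_apply, h, h']

lemma Within.mono (h : Within f a b t) (ht : t ≤ t') : Within f a b t' := by
  obtain ⟨n, hn, h⟩ := h
  exact ⟨n, hn.trans ht, h⟩

lemma Within.iterate (σ : ℕ → α) (N : ℕ) (h : ∀ i < N, Within f (σ i) (σ (i + 1)) t) :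
    Within f (σ 0) (σ N) (N * t) := by
  induction N with
  | zero => exact (Within.refl _).mono (by omega)
  | succ N ih =>
    exact ((ih fun i hi => h i (by omega)).trans (h N (by omega))).mono (by rw [Nat.succ_mul])

end Within

section Simulation

variable [DecidableEq K] {Λ : Type} {D : ℕ}

local notation "MCfg" => TM2.Cfg (fun _ : K ⊕ Fin (D + 1) => Bool) Λ (Option Bool)

/-- The configuration of the machine at the label `l` with stacks `s` and loop counters `c`. -/
def cfg (l : Λ) (s : K → List Bool) (c : Fin (D + 1) → List Bool) : MCfg :=
  ⟨some l, none, Sum.elim s c⟩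

lemma step_popCases_nil (M : Λ → TM2.Stmt (fun _ : K ⊕ Fin (D + 1) => Bool) Λ (Option Bool))
    {l l₁ l₂ : Λ} {k P} (h : M l = popCases k P l₁ l₂) (v : Option Bool)
    (S : K ⊕ Fin (D + 1) → List Bool) (hS : S k = []) :
    TM2.step M ⟨some l, v, S⟩ = some ⟨some l₂, none, S⟩ := by
  simp [h, popCases, hS]

lemma step_popCases_cons (M : Λ → TM2.Stmt (fun _ : K ⊕ Fin (D + 1) => Bool) Λ (Option Bool))
    {l l₁ l₂ : Λ} {k P} (h : M l = popCases k P l₁ l₂) (v : Option Bool)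
    (S : K ⊕ Fin (D + 1) → List Bool) (b : Bool) (r : List Bool) (hS : S k = b :: r) :
    TM2.step M ⟨some l, v, S⟩ = some (TM2.stepAux
      (P (.load (fun _ => none) (.goto fun _ => l₁))) (some b) (update S k r)) := by
  simp [h, popCases, hS]

lemma within_loop_read (M : Λ → TM2.Stmt (fun _ : K ⊕ Fin (D + 1) => Bool) Λ (Option Bool))
    {l l₂ : Λ} {k : K} {j : Fin (D + 1)}
    (h : M l = popCases (.inl k) (fun q => .push (.inr j) (fun o => o.getD false) q) l l₂)
    (L : List Bool) : ∀ (s : K → List Bool) (c : Fin (D + 1) → List Bool), s k = L →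
    Within (TM2.step M) (cfg l s c)
      (cfg l₂ (update s k []) (update c j (L.reverse ++ c j))) (L.length + 1) := by
  induction L with
  | nil =>
    intro s c hs
    refine (Within.single ?_).mono (by simp)
    rw [cfg, step_popCases_nil M h _ _ (by simpa using hs)]
    have hs' : update s k [] = s := by rw [← hs, update_eq_self]
    simp [-Sum.elim_update_left, -Sum.elim_update_right, cfg, hs']
  | cons b L ih =>
    intro s c hs
    have h1 : Within (TM2.step M) (cfg l s c)
        (cfg l (update s k L) (update c j (b :: c j))) 1 := by
      refine Within.single ?_
      rw [cfg, step_popCases_cons M h _ _ b L (by simpa using hs)]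
      simp [-Sum.elim_update_left, -Sum.elim_update_right, cfg]
    have h2 := ih (update s k L) (update c j (b :: c j)) (by simp)
    simp only [update_idem, update_self] at h2
    have h3 := (h1.trans h2).mono (t' := (b :: L).length + 1) (by simp; omega)
    simpa using h3

lemma within_loop_write (M : Λ → TM2.Stmt (fun _ : K ⊕ Fin (D + 1) => Bool) Λ (Option Bool))
    {l l₂ : Λ} {k : K} {i j : Fin (D + 1)} (hij : i ≠ j)
    (h : M l = popCases (.inr j) (fun q => .push (.inl k) (fun o => o.getD false)
      (.push (.inr i) (fun _ => true) q)) l l₂)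
    (L : List Bool) : ∀ (s : K → List Bool) (c : Fin (D + 1) → List Bool), c j = L →
    Within (TM2.step M) (cfg l s c) (cfg l₂ (update s k (L.reverse ++ s k))
      (update (update c j []) i (List.replicate L.length true ++ c i))) (L.length + 1) := by
  induction L with
  | nil =>
    intro s c hs
    refine (Within.single ?_).mono (by simp)
    rw [cfg, step_popCases_nil M h _ _ (by simpa using hs)]
    have hs' : update c j [] = c := by rw [← hs, update_eq_self]
    simp [-Sum.elim_update_left, -Sum.elim_update_right, cfg, hs']
  | cons b L ih =>
    intro s c hs
    have h1 : Within (TM2.step M) (cfg l s c)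
        (cfg l (update s k (b :: s k)) (update (update c j L) i (true :: c i))) 1 := by
      refine Within.single ?_
      rw [cfg, step_popCases_cons M h _ _ b L (by simpa using hs)]
      simp [-Sum.elim_update_left, -Sum.elim_update_right, cfg, hij]
    have h2 := ih (update s k (b :: s k)) (update (update c j L) i (true :: c i))
      (by simp [hij.symm])
    have h3 := (h1.trans h2).mono (t' := (b :: L).length + 1) (by simp; omega)
    convert h3 using 2
    · simp
    · funext r
      by_cases hr : r = i
      · subst hr
        simp [List.replicate_succ']
      · by_cases hr' : r = j
        · subst hr'
          simp [hr]
        · simp [hr, hr']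

theorem Runs.within {B : ℕ} {P : StackProg K} {s s' : K → List Bool} (h : Runs B P s s') :
    ∀ (M : Λ → TM2.Stmt (fun _ : K ⊕ Fin (D + 1) => Bool) Λ (Option Bool)) (e : Lbl P → Λ) (x : Λ)
      (i : ℕ) (c : Fin (D + 1) → List Bool), i + depth P ≤ D →
      (∀ l, M (e l) = code P i e x l) → (∀ j : Fin (D + 1), i ≤ j → c j = []) →
      Within (TM2.step M) (cfg (e (entry P)) s c) (cfg x s' c) ((cost P).eval B) := by
  induction h with
  | skip s =>
    intro M e x i c _ hM _
    refine (Within.single ?_).mono (t := 1) (by simp [cost])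
    rw [cfg, TM2.step, hM]
    simp [-Sum.elim_update_left, -Sum.elim_update_right, cfg, code]
  | push s k b =>
    intro M e x i c _ hM _
    refine (Within.single ?_).mono (t := 1) (by simp [cost])
    rw [cfg, TM2.step, hM]
    simp [-Sum.elim_update_left, -Sum.elim_update_right, cfg, code]
  | pop s k =>
    intro M e x i c _ hM _
    refine (Within.single ?_).mono (t := 1) (by simp [cost])
    rw [cfg, TM2.step, hM]
    simp [-Sum.elim_update_left, -Sum.elim_update_right, cfg, code]
  | @iteTrue s s' k P Q hk _ ih =>
    intro M e x i c hi hM hc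
    have h1 : Within (TM2.step M) (cfg (e (entry (ite k P Q))) s c)
        (cfg (e (some (.inl (entry P)))) s c) 1 := by
      refine Within.single ?_
      have h0 := hM (none : Option _)
      simp only [code] at h0
      rw [cfg, TM2.step]
      change some (TM2.stepAux (M (e (none : Option _))) _ _) = _
      rw [h0]
      simp [cfg, hk]
    have h2 := ih M (fun l => e (some (.inl l))) x i c
      (by simp only [depth] at hi; omega) (fun l => hM _) hc
    exact (h1.trans h2).mono (by simp [cost])
  | @iteFalse s s' k P Q hk _ ih =>
    intro M e x i c hi hM hc
    have h1 : Within (TM2.step M) (cfg (e (entry (ite k P Q))) s c)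
        (cfg (e (some (.inr (entry Q)))) s c) 1 := by
      refine Within.single ?_
      have hk' : ((s k).head? == some true) = false := by simpa using hk
      have h0 := hM (none : Option _)
      simp only [code] at h0
      rw [cfg, TM2.step]
      change some (TM2.stepAux (M (e (none : Option _))) _ _) = _
      rw [h0]
      simp [cfg, hk']
    have h2 := ih M (fun l => e (some (.inr l))) x i c
      (by simp only [depth] at hi; omega) (fun l => hM _) hc
    exact (h1.trans h2).mono (by simp [cost])
  | @seq s s' s'' P Q _ _ ihP ihQ =>
    intro M e x i c hi hM hc
    have h1 := ihP M (fun l => e (.inl l)) (e (.inr (entry Q))) i c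
      (by simp only [depth] at hi; omega) (fun l => hM _) hc
    have h2 := ihQ M (fun l => e (.inr l)) x i c
      (by simp only [depth] at hi; omega) (fun l => hM _) hc
    exact (h1.trans h2).mono (by simp [cost])
  | @loop σ k P N hN hB _ ih =>
    intro M e x i c hi hM hc
    simp only [depth] at hi
    set p : Fin (D + 1) := Fin.ofNat (D + 1) i with hp
    set q : Fin (D + 1) := Fin.ofNat (D + 1) (i + 1) with hq
    have hpv : (p : ℕ) = i := by simp [hp]; omega
    have hqv : (q : ℕ) = i + 1 := by simp [hq]; omega
    have hpq : p ≠ q := fun h => by have := congrArg Fin.val h; omega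
    have hM₂ : M (e (.inr 2)) =
        popCases (.inr p) (fun q => q) (e (.inl (entry P))) x := hM (.inr 2)
    have hcp : c p = [] := hc p (by omega)
    have hcq : c q = [] := hc q (by omega)
    have h1 := within_loop_read M (l := e (.inr 0)) (l₂ := e (.inr 1)) (k := k) (j := q)
      (hM (.inr 0)) (σ 0 k) (σ 0) c rfl
    have h2 := within_loop_write M (l := e (.inr 1)) (l₂ := e (.inr 2)) (k := k) hpq
      (hM (.inr 1)) ((σ 0 k).reverse ++ c q) (update (σ 0) k []) (update c q ((σ 0 k).reverse ++ c q))
      (by simp)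
    have h12 : Within (TM2.step M) (cfg (e (.inr 0)) (σ 0) c)
        (cfg (e (.inr 2)) (σ 0) (update c p (List.replicate N true))) ((N + 1) + (N + 1)) := by
      have h3 := (h1.trans h2).mono (t' := (N + 1) + (N + 1)) (by simp [hcq, hN])
      convert h3 using 2
      · simp [hcq]
      · rw [update_idem, ← hcq, update_eq_self]
        simp [hcp, hcq, hN, hpq]
    have hbody : ∀ j < N, Within (TM2.step M)
        (cfg (e (.inr 2)) (σ j) (update c p (List.replicate (N - j) true)))
        (cfg (e (.inr 2)) (σ (j + 1)) (update c p (List.replicate (N - (j + 1)) true)))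
        ((cost P).eval B + 1) := by
      intro j hj
      have h3 : Within (TM2.step M)
          (cfg (e (.inr 2)) (σ j) (update c p (List.replicate (N - j) true)))
          (cfg (e (.inl (entry P))) (σ j) (update c p (List.replicate (N - (j + 1)) true))) 1 := by
        refine Within.single ?_
        rw [cfg, step_popCases_cons M hM₂ _ _ true (List.replicate (N - (j + 1)) true)]
        · simp [-Sum.elim_update_left, -Sum.elim_update_right, cfg]
        · have : N - j = (N - (j + 1)) + 1 := by omega
          simp [this, List.replicate_succ]
      have h4 := ih j hj M (fun l => e (.inl l)) (e (.inr 2)) (i + 1)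
        (update c p (List.replicate (N - (j + 1)) true)) (by omega) (fun l => hM _) (by
          intro r hr
          have : r ≠ p := fun h => by have := congrArg Fin.val h; omega
          rw [update_of_ne this]
          exact hc r (by omega))
      exact (h3.trans h4).mono (by omega)
    have h5 := Within.iterate
      (fun j => cfg (e (.inr 2)) (σ j) (update c p (List.replicate (N - j) true))) N hbody
    have h6 : Within (TM2.step M) (cfg (e (.inr 2)) (σ N) (update c p (List.replicate (N - N) true)))
        (cfg x (σ N) c) 1 := by
      refine Within.single ?_
      have hcc : update c p (List.replicate (N - N) true) = c := by
        simp [← hcp]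
      rw [hcc, cfg, step_popCases_nil M hM₂ _ _ (by simpa using hcp)]
      rfl
    refine ((h12.trans h5).trans h6).mono ?_
    simp only [cost, Polynomial.eval_add, Polynomial.eval_mul, Polynomial.eval_X,
      Polynomial.eval_ofNat]
    have : N * ((cost P).eval B + 3) ≤ B * ((cost P).eval B + 3) := Nat.mul_le_mul_right _ hB
    nlinarith

end Simulation

/-- The Turing machine that executes a program. -/
def toTM2 [DecidableEq K] [Fintype K] (P : StackProg K) (kin kout : K) : FinTM2 where
  K := K ⊕ Fin (depth P + 1)
  k₀ := .inl kin
  k₁ := .inl kout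
  Γ := fun _ => Bool
  Λ := Option (Lbl P)
  main := some (entry P)
  σ := Option Bool
  initialState := none
  Γk₀Fin := inferInstanceAs (Fintype Bool)
  m := fun l => match l with
    | none => .halt
    | some l => code P 0 some none l

lemma initList_stk_self (tm : FinTM2) (l : List (tm.Γ tm.k₀)) :
    (initList tm l).stk tm.k₀ = l := by
  simp [initList]

lemma initList_stk_of_ne (tm : FinTM2) (l : List (tm.Γ tm.k₀)) {k : tm.K} (h : k ≠ tm.k₀) :
    (initList tm l).stk k = [] := by
  simp [initList, h]

lemma haltList_stk_self (tm : FinTM2) (l : List (tm.Γ tm.k₁)) :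
    (haltList tm l).stk tm.k₁ = l := by
  simp [haltList]

lemma haltList_stk_of_ne (tm : FinTM2) (l : List (tm.Γ tm.k₁)) {k : tm.K} (h : k ≠ tm.k₁) :
    (haltList tm l).stk k = [] := by
  simp [haltList, h]

theorem nonempty_computable [DecidableEq K] [Fintype K] {α β : Type} (P : StackProg K)
    (kin kout : K) (ea : α → List Bool) (eb : β → List Bool) (f : α → β) (p : Polynomial ℕ)
    (h : ∀ x, Runs (p.eval (ea x).length) P (update (fun _ => []) kin (ea x))
      (update (fun _ => []) kout (eb (f x)))) :
    Nonempty (TM2ComputableInPolyTime ea eb f) := by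
  refine ⟨⟨⟨toTM2 P kin kout, Equiv.refl _, Equiv.refl _⟩, (cost P).comp p + 1, fun x => ?_⟩⟩
  have h1 := (h x).within (D := depth P) (toTM2 P kin kout).m some none 0 (fun _ => [])
    (by simp) (fun _ => rfl) (fun _ _ => rfl)
  have h2 : Within (toTM2 P kin kout).step (cfg none (update (fun _ => []) kout (eb (f x)))
      (fun _ => [])) (⟨none, none, Sum.elim (update (fun _ => []) kout (eb (f x))) fun _ => []⟩) 1 :=
    Within.single rfl
  have hin : cfg (some (entry P)) (update (fun _ => []) kin (ea x)) (fun _ => []) =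
      initList (toTM2 P kin kout) (ea x) := by
    unfold cfg initList
    congr 1
    funext k
    rcases k with k | k
    · by_cases hk : k = kin
      · subst hk
        exact (update_self (β := fun _ => List Bool) k (ea x) fun _ => []).trans
          (initList_stk_self (toTM2 P k kout) (ea x)).symm
      · exact (update_of_ne (β := fun _ => List Bool) hk (ea x) fun _ => []).trans
          (initList_stk_of_ne (toTM2 P kin kout) (ea x) fun h => hk (Sum.inl.inj h)).symm
    · exact (initList_stk_of_ne (toTM2 P kin kout) (ea x) fun h => Sum.inr_ne_inl h).symm
  have hout : (⟨none, none, Sum.elim (update (fun _ => []) kout (eb (f x))) fun _ => []⟩ :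
      (toTM2 P kin kout).Cfg) = haltList (toTM2 P kin kout) (eb (f x)) := by
    unfold haltList
    congr 1
    funext k
    rcases k with k | k
    · by_cases hk : k = kout
      · subst hk
        exact (update_self (β := fun _ => List Bool) k (eb (f x)) fun _ => []).trans
          (haltList_stk_self (toTM2 P kin k) (eb (f x))).symm
      · exact (update_of_ne (β := fun _ => List Bool) hk (eb (f x)) fun _ => []).trans
          (haltList_stk_of_ne (toTM2 P kin kout) (eb (f x)) fun h => hk (Sum.inl.inj h)).symm
    · exact (haltList_stk_of_ne (toTM2 P kin kout) (eb (f x)) fun h => Sum.inr_ne_inl h).symm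
  have h3 : Within (toTM2 P kin kout).step (initList (toTM2 P kin kout) (ea x))
      (haltList (toTM2 P kin kout) (eb (f x)))
      ((cost P).eval (p.eval (ea x).length) + 1) := by
    rw [← hin, ← hout]
    exact h1.trans h2
  choose n hn hr using h3
  refine ⟨⟨n, ?_⟩, hn.trans ?_⟩
  · have h₁ : List.map (Equiv.refl Bool).invFun (ea x) = ea x := List.map_id _
    have h₂ : List.map (Equiv.refl Bool).invFun (eb (f x)) = eb (f x) := List.map_id _
    exact (congrArg₂ (fun a b => (flip bind (toTM2 P kin kout).step)^[n]
      (some (initList (toTM2 P kin kout) a)) = some (haltList (toTM2 P kin kout) b)) h₁ h₂).mpr hr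
  · simp

end StackProg

/-- The unary representation of a number. -/
def rep (n : ℕ) : List Bool := List.replicate n true

@[simp] lemma rep_length (n : ℕ) : (rep n).length = n := by simp [rep]

@[simp] lemma rep_zero : rep 0 = [] := rfl

lemma true_cons_rep (n : ℕ) : true :: rep n = rep (n + 1) := rfl

lemma rep_append (m n : ℕ) : rep m ++ rep n = rep (m + n) := by simp [rep]

/-- Apply `F 0`, …, `F (N - 1)` in this order. -/
def iter {α : Type} (F : ℕ → α → α) (x : α) : ℕ → α
  | 0 => x
  | N + 1 => F N (iter F x N)

lemma iter_induction {α : Type} {F : ℕ → α → α} {x : α} (I : α → Prop) (N : ℕ) (hx : I x)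
    (h : ∀ j < N, ∀ y, I y → I (F j y)) : I (iter F x N) := by
  induction N with
  | zero => exact hx
  | succ N ih => exact h N (by omega) _ (ih fun j hj => h j (by omega))

namespace StackProg

variable {K : Type} [DecidableEq K] {B : ℕ} {s s' : K → List Bool}

lemma Runs.loop_of (σ : ℕ → K → List Bool) {k : K} {P : StackProg K} {N : ℕ}
    (h0 : s = σ 0) (hN : (s k).length = N) (hB : N ≤ B)
    (h : ∀ i < N, Runs B P (σ i) (σ (i + 1))) (h' : s' = σ N) : Runs B (StackProg.loop k P) s s' := by
  subst h0 h'
  exact Runs.loop σ hN hB h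

lemma Runs.congr {P : StackProg K} {s'' : K → List Bool} (h : Runs B P s s') (e : s' = s'') :
    Runs B P s s'' := e ▸ h

/-- Make the stack `k` empty. -/
def clear (k : K) : StackProg K := loop k (pop k)

lemma runs_clear {k : K} (hB : (s k).length ≤ B) : Runs B (clear k) s (update s k []) := by
  refine Runs.loop_of (fun i => update s k ((s k).drop i)) (by simp) rfl hB (fun i _ => ?_)
    (by simp)
  refine (Runs.pop _ k).congr ?_
  simp

/-- Add the number on the stack `a` to the number on the stack `t`. -/
def add (a t : K) : StackProg K := loop a (push t true)

lemma runs_add {a t : K} (hB : (s a).length ≤ B) :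
    Runs B (add a t) s (update s t (rep (s a).length ++ s t)) := by
  refine Runs.loop_of (fun i => update s t (rep i ++ s t)) (by simp) rfl hB (fun i _ => ?_) rfl
  refine (Runs.push _ t true).congr ?_
  simp [← true_cons_rep]

/-- Replace `t` by `t * k + v`, with the help of the empty stack `p`. -/
def mulAdd (t k v p : K) : StackProg K :=
  loop t (add k p) ;; add v p ;; clear t ;; add p t ;; clear p

lemma runs_mulAdd {t k v p : K} {x y z : ℕ} (ht : s t = rep x) (hk : s k = rep y)
    (hv : s v = rep z) (hp : s p = []) (htp : t ≠ p) (hkp : k ≠ p) (hvp : v ≠ p)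
    (hx : x ≤ B) (hy : y ≤ B) (hz : z ≤ B) (hxyz : x * y + z ≤ B) :
    Runs B (mulAdd t k v p) s (update s t (rep (x * y + z))) := by
  have h1 : Runs B (loop t (add k p)) s (update s p (rep (x * y))) := by
    refine Runs.loop_of (fun i => update s p (rep (i * y))) (by simp [← hp]) (N := x)
      (by simp [ht]) hx (fun i _ => ?_) rfl
    refine (runs_add (by simp [hkp, hk, hy])).congr ?_
    simp [hkp, hk, rep_append, Nat.succ_mul, add_comm]
  have h2 : Runs B (add v p) (update s p (rep (x * y))) (update s p (rep (x * y + z))) := by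
    refine (runs_add (by simp [hvp, hv, hz])).congr ?_
    simp [hvp, hv, rep_append, add_comm]
  refine h1.seq (h2.seq ((runs_clear (by simp [htp, ht, hx])).seq
    ((runs_add (by simp [htp.symm, hxyz])).seq ((runs_clear (by simp [htp.symm, hxyz])).congr ?_))))
  ext1 r
  simp only [update_apply]
  split_ifs <;> simp_all

/-- Move the top element of the stack `A` to the stack `A'`. -/
def shift (A A' : K) : StackProg K := ite A (push A' true) (push A' false) ;; pop A

lemma runs_shift {A A' : K} (hA : A ≠ A') {b : Bool} {r : List Bool} (h : s A = b :: r) :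
    Runs B (shift A A') s (update (update s A' (b :: s A')) A r) := by
  have h1 : Runs B (ite A (push A' true) (push A' false)) s (update s A' (b :: s A')) := by
    cases b
    · exact Runs.iteFalse _ (by simp [h]) (Runs.push _ _ _)
    · exact Runs.iteTrue _ (by simp [h]) (Runs.push _ _ _)
  refine h1.seq ((Runs.pop _ _).congr ?_)
  simp [hA, h]

lemma runs_loop_shift {A A' k : K} (hA : A ≠ A') {N : ℕ} (hN : (s k).length = N) (hB : N ≤ B)
    (h : N ≤ (s A).length) : Runs B (loop k (shift A A')) s
      (update (update s A' (((s A).take N).reverse ++ s A')) A ((s A).drop N)) := by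
  refine Runs.loop_of
    (fun i => update (update s A' (((s A).take i).reverse ++ s A')) A ((s A).drop i))
    (by simp) hN hB (fun i hi => ?_) rfl
  have hi' : i < (s A).length := by omega
  refine (runs_shift hA (b := (s A)[i]) (r := (s A).drop (i + 1)) (by simp)).congr ?_
  ext1 r
  by_cases hr : r = A
  · subst hr
    simp
  · by_cases hr' : r = A'
    · subst hr'
      simp only [update_of_ne hr, update_self]
      rw [List.take_succ_eq_append_getElem hi', List.reverse_append]
      rfl
    · simp [hr, hr']

/-- Read the bit of the list `A` whose index is on the stack `t` into the empty stack `g`, with the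
help of the empty stack `A'`. -/
def getBit (A A' t g : K) : StackProg K :=
  loop t (shift A A') ;; ite A (push g true) skip ;; loop t (shift A' A)

lemma runs_getBit {A A' t g : K} {N : ℕ} (ht : s t = rep N) (hA' : s A' = []) (hg : s g = [])
    (hN : N < (s A).length) (hB : N ≤ B) (h1 : A ≠ A') (h2 : t ≠ A) (h3 : t ≠ A') (h4 : t ≠ g)
    (h5 : g ≠ A) (h6 : g ≠ A') :
    Runs B (getBit A A' t g) s (update s g (if (s A).getD N false then [true] else [])) := by
  have r1 := runs_loop_shift (B := B) (k := t) h1 (by simp [ht]) hB hN.le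
  set s₁ := update (update s A' (((s A).take N).reverse ++ s A')) A ((s A).drop N) with hs₁
  have r2 : Runs B (ite A (push g true) skip) s₁
      (update s₁ g (if (s A).getD N false then [true] else [])) := by
    have hh : (s₁ A).head? = some ((s A).getD N false) := by
      simp [hs₁, List.getD_eq_getElem?_getD, hN]
    cases hb : (s A).getD N false
    · refine Runs.iteFalse _ (by rw [hh, hb]; simp) ((Runs.skip _).congr ?_)
      have : s₁ g = [] := by simp [hs₁, h5, h6, hg]
      simp [← this]
    · refine Runs.iteTrue _ (by rw [hh, hb]) ((Runs.push _ _ _).congr ?_)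
      have : s₁ g = [] := by simp [hs₁, h5, h6, hg]
      simp [this]
  refine r1.seq (r2.seq ((runs_loop_shift h1.symm (N := N) ?_ hB ?_).congr ?_))
  · simp [hs₁, h2, h3, h4, ht]
  · simp [hs₁, h1.symm, h6.symm]; omega
  · ext1 r
    simp only [hs₁, update_apply]
    split_ifs <;> simp_all
    rw [List.take_of_length_le (by simp)]
    simp

/-- Set the bit of the list `A` whose index is on the stack `t`, with the help of the empty stack
`A'`. -/
def setBit (A A' t : K) (b : Bool) : StackProg K :=
  loop t (shift A A') ;; (pop A ;; push A b) ;; loop t (shift A' A)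

lemma runs_setBit {A A' t : K} {N : ℕ} (b : Bool) (ht : s t = rep N) (hA' : s A' = [])
    (hN : N < (s A).length) (hB : N ≤ B) (h1 : A ≠ A') (h2 : t ≠ A) (h3 : t ≠ A') :
    Runs B (setBit A A' t b) s (update s A ((s A).set N b)) := by
  have r1 := runs_loop_shift (B := B) (k := t) h1 (by simp [ht]) hB hN.le
  set s₁ := update (update s A' (((s A).take N).reverse ++ s A')) A ((s A).drop N) with hs₁
  have r2 : Runs B (pop A ;; push A b) s₁ (update s₁ A (b :: (s A).drop (N + 1))) := by
    refine (Runs.pop _ _).seq ((Runs.push _ _ _).congr ?_)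
    simp [hs₁]
  refine r1.seq (r2.seq ((runs_loop_shift h1.symm (N := N) ?_ hB ?_).congr ?_))
  · simp [hs₁, h2, h3, ht]
  · simp [hs₁, h1.symm]; omega
  · ext1 r
    simp only [hs₁, update_apply]
    split_ifs <;> simp_all [List.set_eq_take_append_cons_drop]
    rw [List.take_of_length_le (by simp)]
    simp

/-- Copy the list `A` to the empty stack `C`, with the help of the empty stack `A'`. -/
def dup (A A' C : K) : StackProg K :=
  loop A (shift A A') ;;
  loop A' (ite A' (push A true ;; push C true) (push A false ;; push C false) ;; pop A')

lemma runs_dup {A A' C : K} (hA' : s A' = []) (hC : s C = []) (hB : (s A).length ≤ B)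
    (h1 : A ≠ A') (h2 : C ≠ A) (h3 : C ≠ A') :
    Runs B (dup A A' C) s (update s C (s A)) := by
  have r1 := runs_loop_shift (s := s) (B := B) (k := A) h1 rfl hB le_rfl
  simp only [List.take_length, List.drop_length, hA', List.append_nil] at r1
  refine r1.seq (Runs.loop_of (fun i => update (update (update s A ((s A).drop ((s A).length - i)))
    C ((s A).drop ((s A).length - i))) A' ((s A).reverse.drop i)) ?_ (N := (s A).length)
    (by simp [h1.symm]) hB (fun i hi => ?_) ?_)
  · ext1 r
    simp only [update_apply]
    split_ifs <;> simp_all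
  · have hrev : (s A).reverse.drop i = (s A)[(s A).length - 1 - i] :: (s A).reverse.drop (i + 1) := by
      rw [List.drop_eq_getElem_cons (by simpa using hi)]
      simp
    have hdrop : (s A).drop ((s A).length - (i + 1)) =
        (s A)[(s A).length - 1 - i] :: (s A).drop ((s A).length - i) := by
      rw [List.drop_eq_getElem_cons (by omega)]
      congr 2 <;> omega
    set b := (s A)[(s A).length - 1 - i]
    set s₁ := update (update (update s A ((s A).drop ((s A).length - i)))
      C ((s A).drop ((s A).length - i))) A' ((s A).reverse.drop i) with hs₁
    have e1 : s₁ A = (s A).drop ((s A).length - i) := by simp [hs₁, h1, h2.symm]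
    have e2 : s₁ C = (s A).drop ((s A).length - i) := by simp [hs₁, h3]
    have e3 : s₁ A' = b :: (s A).reverse.drop (i + 1) := by simp only [hs₁, update_self, hrev]
    have r2 : Runs B (ite A' (push A true ;; push C true) (push A false ;; push C false)) s₁
        (update (update s₁ A (b :: s₁ A)) C (b :: s₁ C)) := by
      have e4 : s₁ C = (update s₁ A (b :: s₁ A)) C := by simp [h2]
      cases hb : b
      · refine Runs.iteFalse _ (by simp [e3, hb])
          ((Runs.push _ _ _).seq ((Runs.push _ _ _).congr ?_))
        rw [e4, hb]
      · refine Runs.iteTrue _ (by simp [e3, hb])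
          ((Runs.push _ _ _).seq ((Runs.push _ _ _).congr ?_))
        rw [e4, hb]
    refine r2.seq ((Runs.pop _ _).congr ?_)
    ext1 r
    simp only [update_apply, h1.symm, h3.symm, if_false, e1, e2, e3, hdrop, List.tail_cons]
    split_ifs <;> simp_all
  · ext1 r
    simp only [update_apply]
    split_ifs <;> simp_all

/-- Run `P` with the loop variable `i` ranging from `0` up to the number on the stack `k`. -/
def forLoop (i k : K) (P : StackProg K) : StackProg K := loop k (P ;; push i true) ;; clear i

lemma runs_forLoop {X : Type} (st : X → K → List Bool) (I : X → Prop) (F : ℕ → X → X)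
    {i k : K} {P : StackProg K} {N : ℕ} {x : X} (hs : s = st x) (hk : s k = rep N) (hN : N ≤ B)
    (hI : I x) (hF : ∀ j < N, ∀ y, I y → I (F j y)) (hi : ∀ y, st y i = [])
    (hP : ∀ j < N, ∀ y, I y →
      Runs B P (update (st y) i (rep j)) (update (st (F j y)) i (rep j))) :
    Runs B (forLoop i k P) s (st (iter F x N)) := by
  refine (Runs.loop_of (fun j => update (st (iter F x j)) i (rep j)) ?_ (N := N) (by simp [hk]) hN
    (fun j hj => ?_) rfl).seq ((runs_clear (by simpa using hN)).congr ?_)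
  · simp [hs, iter, ← hi x]
  · refine (hP j hj _ (iter_induction I j hI fun j' hj' => hF j' (by omega))).seq
      ((Runs.push _ _ _).congr ?_)
    simp [iter, true_cons_rep]
  · simp [← hi (iter F x N)]

/-- Move the leading ones of the stack `A` to the stack `k` and delete the zero that follows them,
with the help of the empty stack `g`. -/
def parseUnary (A k g : K) : StackProg K :=
  loop A (ite g skip (ite A (push k true ;; pop A) (pop A ;; push g true))) ;; clear g

lemma runs_parseUnary {A k g : K} {N : ℕ} {r : List Bool} (hA : s A = rep N ++ false :: r)
    (hk : s k = []) (hg : s g = []) (h1 : k ≠ A) (h2 : g ≠ A) (h3 : g ≠ k)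
    (hB : (s A).length ≤ B) :
    Runs B (parseUnary A k g) s (update (update s A r) k (rep N)) := by
  have hl : (s A).length = N + 1 + r.length := by simp [hA]; omega
  refine (Runs.loop_of (fun i => if i ≤ N then
      update (update s A (rep (N - i) ++ false :: r)) k (rep i)
      else update (update (update s A r) k (rep N)) g [true]) ?_ rfl hB (fun i hi => ?_) rfl).seq
      ((runs_clear ?_).congr ?_)
  · simp [← hA, ← hk]
  · rcases lt_trichotomy i N with h | h | h
    · simp only [h.le, if_true, show i + 1 ≤ N from h]
      have hr : rep (N - i) = true :: rep (N - (i + 1)) := by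
        rw [true_cons_rep]; congr 1; omega
      refine Runs.iteFalse _ (by simp [h2, h3, hg]) (Runs.iteTrue _ (by simp [h1.symm, hr])
        ((Runs.push _ _ _).seq ((Runs.pop _ _).congr ?_)))
      ext1 q
      simp only [update_apply]
      split_ifs <;> simp_all [true_cons_rep]
      rfl
    · subst h
      simp only [le_refl, if_true, show ¬ i + 1 ≤ i by omega, if_false]
      refine Runs.iteFalse _ (by simp [h2, h3, hg]) (Runs.iteFalse _ (by simp [h1.symm])
        ((Runs.pop _ _).seq ((Runs.push _ _ _).congr ?_)))
      ext1 q
      simp only [update_apply]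
      split_ifs <;> simp_all
    · simp only [show ¬ i ≤ N by omega, show ¬ i + 1 ≤ N by omega, if_false]
      exact Runs.iteTrue _ (by simp) (Runs.skip _)
  · simp [hl, show ¬ N + 1 + r.length ≤ N by omega]; omega
  · simp only [hl, show ¬ N + 1 + r.length ≤ N by omega, if_false]
    ext1 q
    simp only [update_apply]
    split_ifs <;> simp_all

end StackProg

/-! ### Tables -/

/-- The position of the entry for the assignments `⟨u, a⟩` and `⟨v, b⟩` in the compatibility table
of an instance with `n` variables and `d` values. -/
def entryIx (n d u a v b : ℕ) : ℕ := ((u * d + a) * n + v) * d + b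

/-- The entry of the table `T` for the assignments `⟨u, a⟩` and `⟨v, b⟩`. -/
def entryAt (n d : ℕ) (T : List Bool) (u a v b : ℕ) : Bool := T.getD (entryIx n d u a v b) false

lemma mul_add_lt_mul {x y z w : ℕ} (hx : x < y) (hz : z < w) : x * w + z < y * w := by
  calc x * w + z < x * w + w := by omega
    _ = (x + 1) * w := by ring
    _ ≤ y * w := Nat.mul_le_mul_right _ hx

lemma entryIx_lt {n d u a v b : ℕ} (hu : u < n) (ha : a < d) (hv : v < n) (hb : b < d) :
    entryIx n d u a v b < n * d * n * d :=
  mul_add_lt_mul (mul_add_lt_mul (mul_add_lt_mul hu ha) hv) hb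

/-- Some value of `w` is compatible with both `⟨u, a⟩` and `⟨v, b⟩`. -/
def supported (n d : ℕ) (T : List Bool) (u a v b w : ℕ) : Bool :=
  (List.range d).any fun c => entryAt n d T u a w c && entryAt n d T w c v b

/-- Disallow the pair of assignments `⟨u, a⟩`, `⟨v, b⟩` if it does not extend to `w`. -/
def revise (n d u a v b w : ℕ) (T : List Bool) : List Bool :=
  if supported n d T u a v b w then T else T.set (entryIx n d u a v b) false

/-- Revise all entries once. -/
def sweep (n d : ℕ) (T : List Bool) : List Bool :=
  iter (fun u T => iter (fun a T => iter (fun v T => iter (fun b T => iter (fun w T =>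
    revise n d u a v b w T) T n) T d) T n) T d) T n

/-- The path consistency closure of a table. -/
def closure3 (n d : ℕ) (T : List Bool) : List Bool := iter (fun _ T => sweep n d T) T T.length

/-- Every variable has a remaining value. -/
def hasValues (n d : ℕ) (T : List Bool) : Bool :=
  (List.range n).all fun w => (List.range d).any fun c => entryAt n d T w c w c

/-- Delete the value `a` of the variable `u` if this does not lead to a contradiction. -/
def tryDelete (n d u a : ℕ) (T : List Bool) : List Bool :=
  if hasValues n d (closure3 n d (T.set (entryIx n d u a u a) false)) then
    closure3 n d (T.set (entryIx n d u a u a) false) else T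

/-- Delete values as long as possible. -/
def searchTable (n d : ℕ) (T : List Bool) : List Bool :=
  iter (fun u T => iter (fun a T => tryDelete n d u a T) T d) T n

/-- Read one bit and store it in the table. -/
def readEntry (n d u a v b : ℕ) (x : List Bool × List Bool) : List Bool × List Bool :=
  (x.1.tail, if x.1.head? = some true then
    (x.2.set (entryIx n d u a v b) true).set (entryIx n d v b u a) true else x.2)

/-- Read the unary constraints. -/
def readUnary (n d : ℕ) (x : List Bool × List Bool) : List Bool × List Bool :=
  iter (fun u x => iter (fun a x => readEntry n d u a u a x) x d) x n

/-- Read the binary constraints. -/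
def readBinary (n d : ℕ) (x : List Bool × List Bool) : List Bool × List Bool :=
  iter (fun u x => iter (fun k x => iter (fun a x => iter (fun b x =>
    readEntry n d u a (u + 1 + k) b x) x d) x d) x (n - u - 1)) x n

/-- The remaining values of the variables, written in reverse. -/
def writeValues (n d : ℕ) (T y : List Bool) : List Bool :=
  iter (fun u y => iter (fun a y => if entryAt n d T u a u a then false :: (rep a ++ y) else y)
    y d) y n

@[simp] lemma revise_length (n d u a v b w : ℕ) (T : List Bool) :
    (revise n d u a v b w T).length = T.length := by
  unfold revise; split_ifs <;> simp

lemma iter_length {F : ℕ → List Bool → List Bool} (h : ∀ j T, (F j T).length = T.length)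
    (T : List Bool) (N : ℕ) : (iter F T N).length = T.length :=
  iter_induction (fun T' => T'.length = T.length) N rfl fun j _ y hy => (h j y).trans hy

@[simp] lemma sweep_length (n d : ℕ) (T : List Bool) : (sweep n d T).length = T.length :=
  iter_length (fun _ _ => iter_length (fun _ _ => iter_length (fun _ _ => iter_length
    (fun _ _ => iter_length (fun _ _ => revise_length ..) _ _) _ _) _ _) _ _) _ _

@[simp] lemma closure3_length (n d : ℕ) (T : List Bool) : (closure3 n d T).length = T.length :=
  iter_length (fun _ _ => sweep_length ..) _ _

@[simp] lemma tryDelete_length (n d u a : ℕ) (T : List Bool) :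
    (tryDelete n d u a T).length = T.length := by
  unfold tryDelete; split_ifs <;> simp

@[simp] lemma readEntry_length (n d u a v b : ℕ) (x : List Bool × List Bool) :
    (readEntry n d u a v b x).2.length = x.2.length := by
  unfold readEntry; dsimp only; split_ifs <;> simp

lemma iter_length_snd {F : ℕ → List Bool × List Bool → List Bool × List Bool}
    (h : ∀ j x, (F j x).2.length = x.2.length) (x : List Bool × List Bool) (N : ℕ) :
    (iter F x N).2.length = x.2.length :=
  iter_induction (fun x' => x'.2.length = x.2.length) N rfl fun j _ y hy => (h j y).trans hy

@[simp] lemma readUnary_length (n d : ℕ) (x : List Bool × List Bool) :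
    (readUnary n d x).2.length = x.2.length :=
  iter_length_snd (fun _ _ => iter_length_snd (fun _ _ => readEntry_length ..) _ _) _ _

lemma iter_any (p : ℕ → Bool) (N : ℕ) :
    iter (fun j y => if p j then [true] else y) [] N =
      if (List.range N).any p then [true] else [] := by
  induction N with
  | zero => rfl
  | succ N ih =>
    rw [iter, ih, List.range_succ]
    cases h : p N <;> simp [h]

lemma iter_all (p : ℕ → Bool) (N : ℕ) :
    iter (fun j y => if p j then y else []) [true] N =
      if (List.range N).all p then [true] else [] := by
  induction N with
  | zero => rfl
  | succ N ih =>
    rw [iter, ih, List.range_succ]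
    cases h : p N <;> simp [h]

/-! ### The program -/

/-- The stacks of the program. -/
inductive Reg : Type
  | inp | out | n | d | r | tab | save | i | j | u | a | v | b | w | c | t | p | x | f | g | h | acc
  deriving DecidableEq

instance Reg.instFintype : Fintype Reg where
  elems := {.inp, .out, .n, .d, .r, .tab, .save, .i, .j, .u, .a, .v, .b, .w, .c, .t, .p, .x, .f,
    .g, .h, .acc}
  complete k := by cases k <;> simp

set_option linter.constructorNameAsVariable false

namespace Reg

open StackProg

/-- The stacks that hold an index of a variable or value. -/
def isIndex : Reg → Bool
  | i | j | u | a | v | b | w | c => true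
  | _ => false

/-- The stacks that hold neither the size of the instance nor the temporary data of table
accesses. -/
def isFree : Reg → Bool
  | n | d | t | p | x | g => false
  | _ => true

lemma ne_of_isIndex {k l : Reg} (hk : k.isIndex = true) (hl : l.isIndex = false) : k ≠ l := by
  rintro rfl; simp [hk] at hl

end Reg

/-- The temporary stacks are empty, and the size of the instance is stored. -/
structure Clean (n d : ℕ) (s : Reg → List Bool) : Prop where
  n : s .n = rep n
  d : s .d = rep d
  t : s .t = []
  p : s .p = []
  x : s .x = []
  g : s .g = []

lemma Clean.update {n d : ℕ} {s : Reg → List Bool} (h : Clean n d s) {k : Reg} (l : List Bool)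
    (hk : k.isFree = true) : Clean n d (update s k l) := by
  obtain ⟨h1, h2, h3, h4, h5, h6⟩ := h
  constructor <;>
  · rw [update_of_ne (by rintro rfl; cases hk)]
    assumption

/-- The numbers that the program handles are at most `B`. -/
structure SizeBound (n d B : ℕ) : Prop where
  n_le : n ≤ B
  d_le : d ≤ B
  one : 1 ≤ B
  nd : n * d ≤ B
  ndn : n * d * n ≤ B
  ndnd : n * d * n * d ≤ B

namespace TableProg

open StackProg Reg

variable {n d B : ℕ} {s s' : Reg → List Bool}

/-- Compute the position of an entry of the table. -/
def computeIx (u a v b : Reg) : StackProg Reg :=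
  add u t ;; mulAdd t .d a p ;; mulAdd t .n v p ;; mulAdd t .d b p

lemma runs_computeIx (hB : SizeBound n d B) (hs : Clean n d s) {u a v b : Reg} {u' a' v' b' : ℕ}
    (ia : a.isIndex) (iv : v.isIndex) (ib : b.isIndex)
    (hu : s u = rep u') (ha : s a = rep a') (hv : s v = rep v') (hb : s b = rep b')
    (lu : u' < n) (la : a' < d) (lv : v' < n) (lb : b' < d) :
    Runs B (computeIx u a v b) s (update s t (rep (entryIx n d u' a' v' b'))) := by
  have h1 := mul_add_lt_mul lu la
  have h2 := mul_add_lt_mul h1 lv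
  have h3 := mul_add_lt_mul h2 lb
  have := hB.n_le
  have := hB.d_le
  have := hB.nd
  have := hB.ndn
  have := hB.ndnd
  have r1 : Runs B (add u t) s (update s t (rep u')) :=
    (runs_add (by simp [hu]; omega)).congr (by simp [hu, hs.t])
  have r2 : Runs B (mulAdd t .d a p) (update s t (rep u')) (update s t (rep (u' * d + a'))) :=
    (runs_mulAdd (x := u') (y := d) (z := a') (by simp) (by simp [hs.d])
      (by simp [ne_of_isIndex ia (l := t) rfl, ha]) (by simp [hs.p]) (by simp) (by simp)
      (ne_of_isIndex ia rfl) (by omega) (by omega) (by omega) (by omega)).congr (by simp)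
  have r3 : Runs B (mulAdd t .n v p) (update s t (rep (u' * d + a')))
      (update s t (rep ((u' * d + a') * n + v'))) :=
    (runs_mulAdd (x := u' * d + a') (y := n) (z := v') (by simp) (by simp [hs.n])
      (by simp [ne_of_isIndex iv (l := t) rfl, hv]) (by simp [hs.p]) (by simp) (by simp)
      (ne_of_isIndex iv rfl) (by omega) (by omega) (by omega) (by omega)).congr (by simp)
  have r4 : Runs B (mulAdd t .d b p) (update s t (rep ((u' * d + a') * n + v')))
      (update s t (rep (entryIx n d u' a' v' b'))) :=
    (runs_mulAdd (x := (u' * d + a') * n + v') (y := d) (z := b') (by simp) (by simp [hs.d])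
      (by simp [ne_of_isIndex ib (l := t) rfl, hb]) (by simp [hs.p]) (by simp) (by simp)
      (ne_of_isIndex ib rfl) (by omega) (by omega) (by omega) (by omega)).congr
      (by simp [entryIx])
  exact r1.seq (r2.seq (r3.seq r4))

/-- Branch on an entry of the table. -/
def testEntry (u a v b : Reg) (P Q : StackProg Reg) : StackProg Reg :=
  computeIx u a v b ;; getBit tab x t g ;; clear t ;; ite g (clear g ;; P) Q

lemma runs_testEntry (hB : SizeBound n d B) (hs : Clean n d s)
    (hT : (s tab).length = n * d * n * d) {u a v b : Reg} {u' a' v' b' : ℕ}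
    (ia : a.isIndex) (iv : v.isIndex) (ib : b.isIndex)
    (hu : s u = rep u') (ha : s a = rep a') (hv : s v = rep v') (hb : s b = rep b')
    (lu : u' < n) (la : a' < d) (lv : v' < n) (lb : b' < d) {P Q : StackProg Reg}
    (hP : entryAt n d (s tab) u' a' v' b' = true → Runs B P s s')
    (hQ : entryAt n d (s tab) u' a' v' b' = false → Runs B Q s s') :
    Runs B (testEntry u a v b P Q) s s' := by
  have hlt := entryIx_lt lu la lv lb
  have := hB.ndnd
  have r1 := runs_computeIx hB hs ia iv ib hu ha hv hb lu la lv lb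
  have r2 := runs_getBit (B := B) (A := tab) (A' := x) (t := t) (g := g)
    (s := update s t (rep (entryIx n d u' a' v' b'))) (N := entryIx n d u' a' v' b')
    (by simp) (by simp [hs.x]) (by simp [hs.g]) (by simp [hT, hlt]) (by omega)
    (by simp) (by simp) (by simp) (by simp) (by simp) (by simp)
  refine r1.seq (r2.seq ((runs_clear (by simp; omega)).seq ?_))
  have e : update (update (update s t (rep (entryIx n d u' a' v' b'))) g
      (if entryAt n d (s tab) u' a' v' b' then [true] else [])) t [] =
      update s g (if entryAt n d (s tab) u' a' v' b' then [true] else []) := by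
    have := hs.t
    ext1 k
    simp only [update_apply]
    split_ifs <;> simp_all
  have e' : ((update s t (rep (entryIx n d u' a' v' b'))) tab).getD (entryIx n d u' a' v' b') false =
      entryAt n d (s tab) u' a' v' b' := by simp [entryAt]
  rw [e', e]
  cases h : entryAt n d (s tab) u' a' v' b'
  · refine Runs.iteFalse _ (by simp) ?_
    simpa [← hs.g] using hQ h
  · refine Runs.iteTrue _ (by simp) ((runs_clear (by simpa using hB.one)).seq ?_)
    simpa [← hs.g] using hP h

/-- Write an entry of the table. -/
def writeEntry (u a v b : Reg) (β : Bool) : StackProg Reg :=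
  computeIx u a v b ;; setBit tab x t β ;; clear t

lemma runs_writeEntry (hB : SizeBound n d B) (hs : Clean n d s)
    (hT : (s tab).length = n * d * n * d) {u a v b : Reg} {u' a' v' b' : ℕ} (β : Bool)
    (ia : a.isIndex) (iv : v.isIndex) (ib : b.isIndex)
    (hu : s u = rep u') (ha : s a = rep a') (hv : s v = rep v') (hb : s b = rep b')
    (lu : u' < n) (la : a' < d) (lv : v' < n) (lb : b' < d) :
    Runs B (writeEntry u a v b β) s
      (update s tab ((s tab).set (entryIx n d u' a' v' b') β)) := by
  have hlt := entryIx_lt lu la lv lb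
  have := hB.ndnd
  have r1 := runs_computeIx hB hs ia iv ib hu ha hv hb lu la lv lb
  have r2 := runs_setBit (B := B) (A := tab) (A' := x) (t := t)
    (s := update s t (rep (entryIx n d u' a' v' b'))) (N := entryIx n d u' a' v' b') β
    (by simp) (by simp [hs.x]) (by simp [hT, hlt]) (by omega) (by simp) (by simp) (by simp)
  refine r1.seq (r2.seq ((runs_clear (by simp; omega)).congr ?_))
  have := hs.t
  ext1 k
  simp only [update_apply]
  split_ifs <;> simp_all

/-- A loop that only changes the stack `R`. -/
lemma runs_forLoop_update {R i k : Reg} (F : ℕ → List Bool → List Bool) {P : StackProg Reg} {N : ℕ}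
    (I : List Bool → Prop) (hk : s k = rep N) (hN : N ≤ B) (hi : s i = []) (hR : i ≠ R)
    (hI : I (s R)) (hF : ∀ j < N, ∀ T, I T → I (F j T))
    (hP : ∀ j < N, ∀ T, I T → Runs B P (update (update s R T) i (rep j))
      (update (update (update s R T) i (rep j)) R (F j T))) :
    Runs B (forLoop i k P) s (update s R (iter F (s R) N)) := by
  refine runs_forLoop (fun T => update s R T) I F (x := s R) (by simp) hk hN hI hF
    (by simp [hR, hi]) fun j hj T hT => (hP j hj T hT).congr ?_
  ext1 q
  simp only [update_apply]
  split_ifs <;> simp_all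

/-- Set `f` if the pair of assignments `⟨u, a⟩`, `⟨v, b⟩` extends to `w`; otherwise disallow it. -/
def reviseProg : StackProg Reg :=
  forLoop c .d (testEntry u a w c (testEntry w c v b (clear f ;; push f true) skip) skip) ;;
  ite f (clear f) (writeEntry u a v b false)

lemma runs_setFlag {k : Reg} (h : (s k).length ≤ B) :
    Runs B (clear k ;; push k true) s (update s k [true]) :=
  (runs_clear h).seq ((Runs.push _ _ _).congr (by simp))

lemma runs_reviseProg (hB : SizeBound n d B) (hs : Clean n d s)
    (hT : (s tab).length = n * d * n * d) {u' a' v' b' w' : ℕ}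
    (hu : s u = rep u') (ha : s a = rep a') (hv : s v = rep v') (hb : s b = rep b')
    (hw : s w = rep w') (hc : s c = []) (hf : s f = [])
    (lu : u' < n) (la : a' < d) (lv : v' < n) (lb : b' < d) (lw : w' < n) :
    Runs B reviseProg s (update s tab (revise n d u' a' v' b' w' (s tab))) := by
  have r1 : Runs B (forLoop c .d
      (testEntry u a w c (testEntry w c v b (clear f ;; push f true) skip) skip)) s
      (update s f (if supported n d (s tab) u' a' v' b' w' then [true] else [])) := by
    refine (runs_forLoop_update (R := f) (fun c' y => if (entryAt n d (s tab) u' a' w' c' &&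
      entryAt n d (s tab) w' c' v' b') then [true] else y) (fun y => y.length ≤ 1) hs.d hB.d_le hc
      (by simp) (by simp [hf]) ?_ ?_).congr ?_
    · intro j _ T hT
      split_ifs
      · simp
      · exact hT
    · intro j hj y hy
      have hs₁ := (hs.update (k := f) y rfl).update (k := c) (rep j) rfl
      have hid : update (update (update s f y) c (rep j)) f y = update (update s f y) c (rep j) := by
        have : (update (update s f y) c (rep j)) f = y := by simp
        conv_lhs => rw [← this]
        simp
      refine runs_testEntry hB hs₁ (by simpa using hT) rfl rfl rfl (by simpa using hu)
        (by simpa using ha) (by simpa using hw) (by simp) lu la lw hj ?_ ?_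
      · intro h1
        refine runs_testEntry hB hs₁ (by simpa using hT) rfl rfl rfl (by simpa using hw)
          (by simp) (by simpa using hv) (by simpa using hb) lw hj lv lb ?_ ?_
        · intro h2
          refine (runs_setFlag (by simpa using hy.trans hB.one)).congr ?_
          simp at h1 h2
          simp [h1, h2]
        · intro h2
          simp at h1 h2
          refine (Runs.skip _).congr ?_
          simp [h1, h2, hid]
      · intro h1
        simp at h1
        refine (Runs.skip _).congr ?_
        simp [h1, hid]
    · rw [hf, iter_any, supported]
  refine r1.seq ?_
  unfold revise
  cases h : supported n d (s tab) u' a' v' b' w'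
  · simp only [Bool.false_eq_true, if_false]
    have : update s f [] = s := by simp [← hf]
    rw [this]
    exact Runs.iteFalse _ (by simp [hf])
      (runs_writeEntry hB hs hT _ rfl rfl rfl hu ha hv hb lu la lv lb)
  · simp only [if_true]
    refine Runs.iteTrue _ (by simp) ((runs_clear (by simpa using hB.one)).congr ?_)
    simp [← hf]

/-- The program for `sweep`. -/
def sweepProg : StackProg Reg :=
  forLoop u .n (forLoop a .d (forLoop v .n (forLoop b .d (forLoop w .n reviseProg))))

/-- The stacks that `sweepProg` uses are empty. -/
structure SweepReady (s : Reg → List Bool) : Prop where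
  u : s .u = []
  a : s .a = []
  v : s .v = []
  b : s .b = []
  w : s .w = []
  c : s .c = []
  f : s .f = []

lemma runs_sweepProg (hB : SizeBound n d B) (hs : Clean n d s) (hr : SweepReady s)
    (hT : (s tab).length = n * d * n * d) :
    Runs B sweepProg s (update s tab (sweep n d (s tab))) := by
  refine runs_forLoop_update (R := tab) (fun u T => iter (fun a T => iter (fun v T => iter (fun b T =>
    iter (fun w T => revise n d u a v b w T) T n) T d) T n) T d) (fun T => T.length = n * d * n * d)
    hs.n hB.n_le hr.u (by simp) hT (fun _ _ T hT => ?_) fun u' lu T₁ hT₁ => ?_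
  · rw [← hT]
    exact iter_length (fun _ _ => iter_length (fun _ _ => iter_length
      (fun _ _ => iter_length (fun _ _ => revise_length ..) _ _) _ _) _ _) _ _
  set s₁ := update (update s tab T₁) u (rep u') with hs₁
  have c₁ : Clean n d s₁ := (hs.update _ rfl).update _ rfl
  refine (runs_forLoop_update (R := tab) (fun a T => iter (fun v T => iter (fun b T =>
    iter (fun w T => revise n d u' a v b w T) T n) T d) T n) (fun T => T.length = n * d * n * d)
    c₁.d hB.d_le (by simp [hs₁, hr.a]) (by simp) (by simpa [hs₁] using hT₁) (fun _ _ T hT => ?_)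
    fun a' la T₂ hT₂ => ?_).congr (by simp [hs₁])
  · rw [← hT]
    exact iter_length (fun _ _ => iter_length (fun _ _ => iter_length
      (fun _ _ => revise_length ..) _ _) _ _) _ _
  set s₂ := update (update s₁ tab T₂) a (rep a') with hs₂
  have c₂ : Clean n d s₂ := (c₁.update _ rfl).update _ rfl
  refine (runs_forLoop_update (R := tab) (fun v T => iter (fun b T =>
    iter (fun w T => revise n d u' a' v b w T) T n) T d) (fun T => T.length = n * d * n * d)
    c₂.n hB.n_le (by simp [hs₁, hs₂, hr.v]) (by simp) (by simpa [hs₂] using hT₂) (fun _ _ T hT => ?_)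
    fun v' lv T₃ hT₃ => ?_).congr (by simp [hs₂])
  · rw [← hT]
    exact iter_length (fun _ _ => iter_length (fun _ _ => revise_length ..) _ _) _ _
  set s₃ := update (update s₂ tab T₃) v (rep v') with hs₃
  have c₃ : Clean n d s₃ := (c₂.update _ rfl).update _ rfl
  refine (runs_forLoop_update (R := tab) (fun b T =>
    iter (fun w T => revise n d u' a' v' b w T) T n) (fun T => T.length = n * d * n * d)
    c₃.d hB.d_le (by simp [hs₁, hs₂, hs₃, hr.b]) (by simp) (by simpa [hs₃] using hT₃)
    (fun _ _ T hT => ?_) fun b' lb T₄ hT₄ => ?_).congr (by simp [hs₃])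
  · rw [← hT]
    exact iter_length (fun _ _ => revise_length ..) _ _
  set s₄ := update (update s₃ tab T₄) b (rep b') with hs₄
  have c₄ : Clean n d s₄ := (c₃.update _ rfl).update _ rfl
  refine (runs_forLoop_update (R := tab) (fun w T => revise n d u' a' v' b' w T)
    (fun T => T.length = n * d * n * d)
    c₄.n hB.n_le (by simp [hs₁, hs₂, hs₃, hs₄, hr.w]) (by simp) (by simpa [hs₄] using hT₄)
    (fun _ _ T hT => by simpa using hT) fun w' lw T₅ hT₅ => ?_).congr (by simp [hs₄])
  exact (runs_reviseProg hB ((c₄.update _ rfl).update _ rfl) (by simpa using hT₅)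
    (by simp [hs₁, hs₂, hs₃, hs₄]) (by simp [hs₂, hs₃, hs₄]) (by simp [hs₃, hs₄])
    (by simp [hs₄]) (by simp) (by simp [hs₁, hs₂, hs₃, hs₄, hr.c])
    (by simp [hs₁, hs₂, hs₃, hs₄, hr.f]) lu la lv lb lw).congr (by simp)

lemma SweepReady.update (h : SweepReady s) {k : Reg} (l : List Bool)
    (hk : k ∉ [Reg.u, .a, .v, .b, .w, .c, .f]) : SweepReady (update s k l) := by
  obtain ⟨h1, h2, h3, h4, h5, h6, h7⟩ := h
  constructor <;>
  · rw [update_of_ne (by rintro rfl; simp at hk)]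
    assumption

/-- The program for `closure3`. -/
def closureProg : StackProg Reg := loop tab sweepProg

lemma runs_closureProg (hB : SizeBound n d B) (hs : Clean n d s) (hr : SweepReady s)
    (hT : (s tab).length = n * d * n * d) :
    Runs B closureProg s (update s tab (closure3 n d (s tab))) := by
  refine Runs.loop_of (fun j => update s tab (iter (fun _ T => sweep n d T) (s tab) j))
    (by simp [iter]) rfl (hT ▸ hB.ndnd) (fun j _ => ?_) rfl
  refine (runs_sweepProg hB (hs.update _ rfl) (hr.update _ (by simp)) ?_).congr ?_
  · simpa [iter_length (F := fun _ T => sweep n d T) (fun _ _ => sweep_length ..)] using hT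
  · simp [iter]

/-- The program for `hasValues`. -/
def hasValuesProg : StackProg Reg :=
  push f true ;; forLoop w .n (forLoop c .d (testEntry w c w c (clear h ;; push h true) skip) ;;
    ite h (clear h) (clear f))

lemma runs_hasValuesProg (hB : SizeBound n d B) (hs : Clean n d s) (hr : SweepReady s)
    (hh : s h = []) (hT : (s tab).length = n * d * n * d) :
    Runs B hasValuesProg s (update s f (if hasValues n d (s tab) then [true] else [])) := by
  have r1 : Runs B (push f true) s (update s f [true]) :=
    (Runs.push _ _ _).congr (by simp [hr.f])
  refine r1.seq ?_
  refine (runs_forLoop_update (R := f)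
    (fun w' y => if (List.range d).any fun c' => entryAt n d (s tab) w' c' w' c' then y else [])
    (fun y => y.length ≤ 1) (by simp [hs.n]) hB.n_le (by simp [hr.w]) (by simp)
    (by simp) ?_ ?_).congr ?_
  · intro j _ T hT
    split_ifs
    · exact hT
    · simp
  · intro w' lw y hy
    simp only [update_idem]
    set s₁ := update (update s f y) w (rep w') with hs₁
    have c₁ : Clean n d s₁ := (hs.update _ rfl).update _ rfl
    have hid : update s₁ f y = s₁ := by
      have : s₁ f = y := by simp [hs₁]
      conv_lhs => rw [← this]
      simp
    have r2 : Runs B (forLoop c .d (testEntry w c w c (clear h ;; push h true) skip)) s₁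
        (update s₁ h (if (List.range d).any fun c' => entryAt n d (s tab) w' c' w' c'
          then [true] else [])) := by
      refine (runs_forLoop_update (R := h) (fun c' y => if entryAt n d (s tab) w' c' w' c'
        then [true] else y) (fun y => y.length ≤ 1) c₁.d hB.d_le (by simp [hs₁, hr.c])
        (by simp) (by simp [hs₁, hh]) ?_ ?_).congr ?_
      · intro j _ T hT
        split_ifs
        · simp
        · exact hT
      · intro c' lc z hz
        set s₂ := update (update s₁ h z) c (rep c') with hs₂
        have c₂ : Clean n d s₂ := (c₁.update _ rfl).update _ rfl
        refine runs_testEntry hB c₂ (by simpa [hs₁, hs₂] using hT) rfl rfl rfl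
          (u' := w') (by simp [hs₁, hs₂]) (a' := c') (by simp [hs₂]) (by simp [hs₁, hs₂])
          (by simp [hs₂]) lw lc lw lc ?_ ?_
        · intro h1
          refine (runs_setFlag (by simpa [hs₂] using hz.trans hB.one)).congr ?_
          simp [hs₁, hs₂] at h1
          simp [h1]
        · intro h1
          refine (Runs.skip _).congr ?_
          simp [hs₁, hs₂] at h1
          have : s₂ h = z := by simp [hs₂]
          simp [h1, ← this]
      · have : s₁ h = [] := by simp [hs₁, hh]
        rw [this, iter_any]
    refine r2.seq ?_
    have hh₁ : update s₁ h [] = s₁ := by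
      have : s₁ h = [] := by simp [hs₁, hh]
      simp [← this]
    split_ifs
    · refine Runs.iteTrue _ (by simp) ((runs_clear (by simpa using hB.one)).congr ?_)
      simp [hid, hh₁]
    · rw [hh₁]
      refine Runs.iteFalse _ (by simp [hs₁, hh]) (runs_clear ?_)
      simpa [hs₁] using hy.trans hB.one
  · simp only [update_self, update_idem, iter_all, hasValues]
    congr

/-- The program for `tryDelete`. -/
def tryDeleteProg : StackProg Reg :=
  dup tab x save ;; writeEntry i j i j false ;; closureProg ;; hasValuesProg ;;
  ite f (clear f ;; clear save) (clear tab ;; dup save x tab ;; clear save)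

lemma runs_tryDeleteProg (hB : SizeBound n d B) (hs : Clean n d s) (hr : SweepReady s)
    (hh : s h = []) (hS : s save = []) (hT : (s tab).length = n * d * n * d) {u' a' : ℕ}
    (hi : s i = rep u') (hj : s j = rep a') (lu : u' < n) (la : a' < d) :
    Runs B tryDeleteProg s (update s tab (tryDelete n d u' a' (s tab))) := by
  have hT' : (s tab).length ≤ B := hT ▸ hB.ndnd
  have r1 := runs_dup (B := B) (A := tab) (A' := x) (C := save) (s := s) hs.x hS hT'
    (by simp) (by simp) (by simp)
  set s₁ := update s save (s tab) with hs₁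
  have c₁ : Clean n d s₁ := hs.update _ rfl
  have k₁ : SweepReady s₁ := hr.update _ (by simp)
  have r2 := runs_writeEntry (s := s₁) hB c₁ (by simpa [hs₁] using hT) false (u := i) (a := j)
    (v := i) (b := j) rfl rfl rfl (by simpa [hs₁] using hi) (by simpa [hs₁] using hj)
    (by simpa [hs₁] using hi) (by simpa [hs₁] using hj) lu la lu la
  have e₁ : s₁ tab = s tab := by simp [hs₁]
  rw [e₁] at r2
  set T₂ := (s tab).set (entryIx n d u' a' u' a') false with hT₂
  have r3 := runs_closureProg hB (c₁.update (k := tab) T₂ rfl) (k₁.update T₂ (by simp))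
    (by simpa [hT₂] using hT)
  simp only [update_self, update_idem] at r3
  set T₃ := closure3 n d T₂ with hT₃
  have r4 := runs_hasValuesProg hB (c₁.update (k := tab) T₃ rfl) (k₁.update T₃ (by simp))
    (by simpa [hs₁] using hh) (by simpa [hT₃, hT₂] using hT)
  refine r1.seq (r2.seq (r3.seq (r4.seq ?_)))
  simp only [update_self]
  unfold tryDelete
  have hf := hr.f
  split_ifs with hv
  · refine Runs.iteTrue _ (by simp) ((runs_clear (by simpa using hB.one)).seq
      ((runs_clear (by simpa [hs₁] using hT')).congr ?_))
    ext1 q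
    simp only [hs₁, update_apply]
    split_ifs <;> simp_all
  · have hl : T₃.length ≤ B := by simpa [hT₃, hT₂] using hT'
    refine Runs.iteFalse _ (by simp) ((runs_clear (by simpa using hl)).seq
      ((runs_dup ?_ ?_ ?_ (by simp) (by simp) (by simp)).seq ((runs_clear ?_).congr ?_)))
    · simp [hs₁, hs.x]
    · simp
    · simpa [hs₁] using hT'
    · simpa [hs₁] using hT'
    · ext1 q
      simp only [hs₁, update_apply]
      split_ifs <;> simp_all

/-- The program for `searchTable`. -/
def searchProg : StackProg Reg := forLoop i .n (forLoop j .d tryDeleteProg)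

lemma runs_searchProg (hB : SizeBound n d B) (hs : Clean n d s) (hr : SweepReady s)
    (hh : s h = []) (hS : s save = []) (hT : (s tab).length = n * d * n * d)
    (hi : s i = []) (hj : s j = []) :
    Runs B searchProg s (update s tab (searchTable n d (s tab))) := by
  refine runs_forLoop_update (R := tab) (fun u T => iter (fun a T => tryDelete n d u a T) T d)
    (fun T => T.length = n * d * n * d)
    hs.n hB.n_le hi (by simp) hT (fun _ _ T hT => ?_) fun u' lu T₁ hT₁ => ?_
  · rw [← hT]
    exact iter_length (fun _ _ => tryDelete_length ..) _ _
  set s₁ := update (update s tab T₁) i (rep u') with hs₁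
  have c₁ : Clean n d s₁ := (hs.update _ rfl).update _ rfl
  have k₁ : SweepReady s₁ := (hr.update _ (by simp)).update _ (by simp)
  refine (runs_forLoop_update (R := tab) (fun a T => tryDelete n d u' a T) (fun T => T.length = n * d * n * d)
    c₁.d hB.d_le (by simp [hs₁, hj]) (by simp) (by simpa [hs₁] using hT₁)
    (fun _ _ T hT => by simpa using hT) fun a' la T₂ hT₂ => ?_).congr (by simp [hs₁])
  exact (runs_tryDeleteProg hB ((c₁.update _ rfl).update _ rfl)
    ((k₁.update _ (by simp)).update _ (by simp)) (by simp [hs₁, hh]) (by simp [hs₁, hS])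
    (by simpa using hT₂) (by simp [hs₁]) (by simp) lu la).congr (by simp)

end TableProg

namespace TableProg

open StackProg Reg

variable {n d B : ℕ} {s s' : Reg → List Bool}

/-- Replace the remaining input and the table. -/
def setIO (s : Reg → List Bool) (y : List Bool × List Bool) : Reg → List Bool :=
  update (update s inp y.1) tab y.2

@[simp] lemma setIO_inp (s : Reg → List Bool) (y) : setIO s y inp = y.1 := by simp [setIO]

@[simp] lemma setIO_tab (s : Reg → List Bool) (y) : setIO s y tab = y.2 := by simp [setIO]

lemma setIO_of_ne (s : Reg → List Bool) (y) {k : Reg} (h₁ : k ≠ inp) (h₂ : k ≠ tab) :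
    setIO s y k = s k := by simp [setIO, h₁, h₂]

lemma setIO_self (s : Reg → List Bool) : setIO s (s inp, s tab) = s := by simp [setIO]

lemma setIO_setIO (s : Reg → List Bool) (y z) : setIO (setIO s y) z = setIO s z := by
  ext1 k
  simp only [setIO, update_apply]
  split_ifs <;> rfl

lemma setIO_update (s : Reg → List Bool) (y) {k : Reg} (l : List Bool) (h₁ : k ≠ inp)
    (h₂ : k ≠ tab) : setIO (update s k l) y = update (setIO s y) k l := by
  ext1 q
  simp only [setIO, update_apply]
  split_ifs <;> simp_all

lemma Clean.setIO (hs : Clean n d s) (y) : Clean n d (setIO s y) :=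
  (hs.update _ rfl).update _ rfl

/-- A loop that only changes the remaining input and the table. -/
lemma runs_forLoop_setIO {i k : Reg} (F : ℕ → List Bool × List Bool → List Bool × List Bool)
    {P : StackProg Reg} {N L : ℕ} (hk : s k = rep N) (hN : N ≤ B) (hi : s i = [])
    (h₁ : i ≠ inp) (h₂ : i ≠ tab) (hL : (s tab).length = L)
    (hF : ∀ j y, (F j y).2.length = y.2.length)
    (hP : ∀ j < N, ∀ y, y.2.length = L → Runs B P (update (setIO s y) i (rep j))
      (setIO (update (setIO s y) i (rep j)) (F j y))) :
    Runs B (forLoop i k P) s (setIO s (iter F (s inp, s tab) N)) := by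
  refine runs_forLoop (fun y => setIO s y) (fun y => y.2.length = L) F (x := (s inp, s tab))
    (setIO_self s).symm hk hN hL (fun j _ y hy => (hF j y).trans hy)
    (fun y => by rw [setIO_of_ne _ _ h₁ h₂, hi]) fun j hj y hy => (hP j hj y hy).congr ?_
  rw [setIO_update _ _ _ h₁ h₂, setIO_setIO]

/-- The program for `readEntry`. -/
def readProg (u a v b : Reg) : StackProg Reg :=
  ite inp (writeEntry u a v b true ;; writeEntry v b u a true) skip ;; pop inp

lemma runs_readProg (hB : SizeBound n d B) (hs : Clean n d s)
    (hT : (s tab).length = n * d * n * d) {u a v b : Reg} {u' a' v' b' : ℕ}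
    (iu : u.isIndex) (ia : a.isIndex) (iv : v.isIndex) (ib : b.isIndex)
    (hu : s u = rep u') (ha : s a = rep a') (hv : s v = rep v') (hb : s b = rep b')
    (lu : u' < n) (la : a' < d) (lv : v' < n) (lb : b' < d) :
    Runs B (readProg u a v b) s (setIO s (readEntry n d u' a' v' b' (s inp, s tab))) := by
  have ne {k : Reg} (h : k.isIndex) : k ≠ tab := ne_of_isIndex h rfl
  unfold readEntry
  by_cases h : (s inp).head? = some true
  · have r1 := runs_writeEntry hB hs hT true ia iv ib hu ha hv hb lu la lv lb
    have r2 := runs_writeEntry hB (hs.update (k := tab)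
      ((s tab).set (entryIx n d u' a' v' b') true) rfl) (by simpa using hT) true (u := v) (a := b)
      (v := u) (b := a) ib iu ia
      (by simpa [ne iv] using hv) (by simpa [ne ib] using hb) (by simpa [ne iu] using hu)
      (by simpa [ne ia] using ha) lv lb lu la
    refine (Runs.iteTrue _ h (r1.seq r2)).seq ((Runs.pop _ _).congr ?_)
    ext1 k
    simp only [h, if_true, setIO, update_apply]
    split_ifs <;> simp_all
  · refine (Runs.iteFalse _ h (Runs.skip _)).seq ((Runs.pop _ _).congr ?_)
    ext1 k
    simp only [h, if_false, setIO, update_apply]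
    split_ifs <;> simp_all

/-- The program for `readUnary`. -/
def readUnaryProg : StackProg Reg := forLoop u .n (forLoop a .d (readProg u a u a))

lemma runs_readUnaryProg (hB : SizeBound n d B) (hs : Clean n d s)
    (hT : (s tab).length = n * d * n * d) (hu : s u = []) (ha : s a = []) :
    Runs B readUnaryProg s (setIO s (readUnary n d (s inp, s tab))) := by
  refine runs_forLoop_setIO _ hs.n hB.n_le hu (by simp) (by simp) hT
    (fun _ _ => iter_length_snd (fun _ _ => readEntry_length ..) _ _) fun u' lu y hy => ?_
  set s₁ := update (setIO s y) u (rep u') with hs₁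
  have c₁ : Clean n d s₁ := (Clean.setIO hs _).update _ rfl
  refine (runs_forLoop_setIO (fun a y => readEntry n d u' a u' a y) c₁.d hB.d_le
    (by simp [hs₁, setIO, ha]) (by simp) (by simp) (by simpa [hs₁] using hy)
    (fun _ _ => readEntry_length ..) fun a' la z hz => ?_).congr (by simp [hs₁])
  exact (runs_readProg hB ((Clean.setIO c₁ _).update _ rfl) (by simpa using hz) rfl rfl rfl rfl
    (by simp [setIO, hs₁]) (by simp) (by simp [setIO, hs₁]) (by simp) lu la lu la).congr (by simp)

/-- The program for `readBinary`. -/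
def readBinaryProg : StackProg Reg :=
  forLoop u .n (add .n r ;; loop u (pop r) ;; pop r ;; add u v ;;
    loop r (push v true ;; forLoop a .d (forLoop b .d (readProg u a v b))) ;; clear v ;; clear r)

lemma runs_readBinaryProg (hB : SizeBound n d B) (hs : Clean n d s)
    (hT : (s tab).length = n * d * n * d) (hu : s u = []) (ha : s a = []) (hv : s v = [])
    (hb : s b = []) (hr : s r = []) :
    Runs B readBinaryProg s (setIO s (readBinary n d (s inp, s tab))) := by
  have hBn := hB.n_le
  refine runs_forLoop_setIO _ hs.n hB.n_le hu (by simp) (by simp) hT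
    (fun _ _ => iter_length_snd (fun _ _ => iter_length_snd (fun _ _ => iter_length_snd
      (fun _ _ => readEntry_length ..) _ _) _ _) _ _) fun u' lu y hy => ?_
  set s₁ := update (setIO s y) u (rep u') with hs₁
  have c₁ : Clean n d s₁ := (Clean.setIO hs _).update _ rfl
  have hr₁ : s₁ r = [] := by simp [hs₁, setIO, hr]
  have hv₁ : s₁ v = [] := by simp [hs₁, setIO, hv]
  have hu₁ : s₁ u = rep u' := by simp [hs₁]
  have r1 : Runs B (add .n r) s₁ (update s₁ r (rep n)) :=
    (runs_add (by simp [c₁.n, hBn])).congr (by simp [c₁.n, hr₁])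
  have r2 : Runs B (loop u (pop r)) (update s₁ r (rep n)) (update s₁ r (rep (n - u'))) := by
    refine Runs.loop_of (fun j => update s₁ r (rep (n - j))) (by simp) (N := u') (by simp [hu₁])
      (by omega) (fun j hj => (Runs.pop _ _).congr ?_) rfl
    have : n - j = n - (j + 1) + 1 := by omega
    simp [this, ← true_cons_rep]
  have r3 : Runs B (pop r) (update s₁ r (rep (n - u'))) (update s₁ r (rep (n - u' - 1))) := by
    refine (Runs.pop _ _).congr ?_
    have : n - u' = n - u' - 1 + 1 := by omega
    conv_lhs => rw [this]
    simp [← true_cons_rep]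
  set s₂ := update s₁ r (rep (n - u' - 1)) with hs₂
  have c₂ : Clean n d s₂ := c₁.update _ rfl
  have r4 : Runs B (add u v) s₂ (update s₂ v (rep u')) :=
    (runs_add (by simp [hs₂, hu₁]; omega)).congr (by simp [hs₂, hu₁, hv₁])
  have r5 : Runs B (loop r (push v true ;; forLoop a .d (forLoop b .d (readProg u a v b))))
      (update s₂ v (rep u')) (update (setIO s₂ (iter (fun k x => iter (fun a x => iter (fun b x =>
        readEntry n d u' a (u' + 1 + k) b x) x d) x d) y (n - u' - 1))) v
        (rep (u' + (n - u' - 1)))) := by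
    refine Runs.loop_of (fun k => update (setIO s₂ (iter (fun k x => iter (fun a x => iter
      (fun b x => readEntry n d u' a (u' + 1 + k) b x) x d) x d) y k)) v (rep (u' + k))) ?_
      (N := n - u' - 1) (by simp [hs₂]) (by omega) (fun k hk => ?_) rfl
    · have : setIO s₂ y = s₂ := by
        have h₁ : s₂ inp = y.1 := by simp [hs₂, hs₁]
        have h₂ : s₂ tab = y.2 := by simp [hs₂, hs₁]
        conv_rhs => rw [← setIO_self s₂, h₁, h₂]
      simp [iter, this]
    · have hlen : (iter (fun k x => iter (fun a x => iter
          (fun b x => readEntry n d u' a (u' + 1 + k) b x) x d) x d) y k).2.length =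
          n * d * n * d := by
        rw [← hy]
        exact iter_length_snd (fun _ _ => iter_length_snd (fun _ _ => iter_length_snd
          (fun _ _ => readEntry_length ..) _ _) _ _) _ _
      simp only [iter]
      set z := iter (fun k x => iter (fun a x => iter
          (fun b x => readEntry n d u' a (u' + 1 + k) b x) x d) x d) y k
      have r6 : Runs B (push v true) (update (setIO s₂ z) v (rep (u' + k)))
          (update (setIO s₂ z) v (rep (u' + 1 + k))) := by
        refine (Runs.push _ _ _).congr ?_
        have : u' + 1 + k = u' + k + 1 := by omega
        simp [this, ← true_cons_rep]
      refine r6.seq ?_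
      set s₃ := update (setIO s₂ z) v (rep (u' + 1 + k)) with hs₃
      have c₃ : Clean n d s₃ := (Clean.setIO c₂ _).update _ rfl
      refine (runs_forLoop_setIO (fun a x => iter
          (fun b x => readEntry n d u' a (u' + 1 + k) b x) x d) c₃.d hB.d_le
          (by simp [hs₃, hs₂, hs₁, setIO, ha]) (by simp) (by simp) (by simpa [hs₃] using hlen)
          (fun _ _ => iter_length_snd (fun _ _ => readEntry_length ..) _ _)
          fun a' la y₁ hy₁ => ?_).congr ?_
      · set s₄ := update (setIO s₃ y₁) a (rep a') with hs₄
        have c₄ : Clean n d s₄ := (Clean.setIO c₃ _).update _ rfl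
        refine (runs_forLoop_setIO (fun b x => readEntry n d u' a' (u' + 1 + k) b x) c₄.d hB.d_le
          (by simp [hs₄, hs₃, hs₂, hs₁, setIO, hb]) (by simp) (by simp) (by simpa [hs₄] using hy₁)
          (fun _ _ => readEntry_length ..) fun b' lb y₂ hy₂ => ?_).congr (by simp [hs₄])
        exact (runs_readProg hB ((Clean.setIO c₄ _).update _ rfl) (by simpa using hy₂)
          rfl rfl rfl rfl (u' := u') (a' := a') (v' := u' + 1 + k) (b' := b')
          (by simp [hs₄, hs₃, hs₂, hs₁, setIO])
          (by simp [hs₄, setIO]) (by simp [hs₄, hs₃, setIO]) (by simp) lu la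
          (by omega) lb).congr (by simp)
      · have h₁ : s₃ inp = z.1 := by simp [hs₃]
        have h₂ : s₃ tab = z.2 := by simp [hs₃]
        rw [h₁, h₂, Prod.mk.eta, hs₃, setIO_update _ _ _ (by simp) (by simp), setIO_setIO,
          show u' + 1 + k = u' + (k + 1) by omega]
  refine r1.seq (r2.seq (r3.seq (r4.seq (r5.seq ((runs_clear (by simp; omega)).seq
    ((runs_clear (by simp [setIO, hs₂]; omega)).congr ?_))))))
  ext1 k
  simp only [setIO, hs₂, update_apply]
  split_ifs <;> simp_all

/-- Allocate the table. -/
def allocProg : StackProg Reg := loop .n (loop .d (loop .n (loop .d (push tab false))))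

lemma runs_loop_alloc {k : Reg} {P : StackProg Reg} {N c : ℕ} (hk : s k = rep N) (hN : N ≤ B)
    (hkt : k ≠ tab) (hP : ∀ T, Runs B P (update s tab T)
      (update s tab (List.replicate c false ++ T))) (T : List Bool) :
    Runs B (loop k P) (update s tab T) (update s tab (List.replicate (N * c) false ++ T)) := by
  refine Runs.loop_of (fun j => update s tab (List.replicate (j * c) false ++ T)) (by simp)
    (N := N) (by simp [hkt, hk]) hN (fun j _ => (hP _).congr ?_) rfl
  rw [← List.append_assoc, List.replicate_append_replicate, Nat.succ_mul, add_comm]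

lemma runs_allocProg (hB : SizeBound n d B) (hs : Clean n d s) (hT : s tab = []) :
    Runs B allocProg s (update s tab (List.replicate (n * d * n * d) false)) := by
  have h := runs_loop_alloc hs.n hB.n_le (by simp) (runs_loop_alloc hs.d hB.d_le (by simp)
    (runs_loop_alloc hs.n hB.n_le (by simp) (runs_loop_alloc (c := 1) (P := push tab false)
      hs.d hB.d_le (by simp) fun T => (Runs.push _ _ _).congr (by simp)))) []
  rw [← hT, update_eq_self, hT, List.append_nil] at h
  rw [show n * d * n * d = n * (d * (n * (d * 1))) by ring]
  exact h

/-- The program for `writeValues`. -/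
def outputProg : StackProg Reg :=
  push acc true ;; forLoop i .n (forLoop j .d (testEntry i j i j (add j acc ;; push acc false) skip)) ;;
    loop acc (shift acc out)

lemma runs_outputProg (hB : SizeBound n d B) (hs : Clean n d s)
    (hT : (s tab).length = n * d * n * d) (hi : s i = []) (hj : s j = []) (hacc : s acc = [])
    (hout : s out = []) (hl : (writeValues n d (s tab) [true]).length ≤ B) :
    Runs B outputProg s (update s out (writeValues n d (s tab) [true]).reverse) := by
  have r1 : Runs B (push acc true) s (update s acc [true]) :=
    (Runs.push _ _ _).congr (by simp [hacc])
  have r2 : Runs B (forLoop i .n (forLoop j .d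
      (testEntry i j i j (add j acc ;; push acc false) skip))) (update s acc [true])
      (update s acc (writeValues n d (s tab) [true])) := by
    refine (runs_forLoop_update (R := acc) (fun u y => iter (fun a y =>
      if entryAt n d (s tab) u a u a then false :: (rep a ++ y) else y) y d) (fun _ => True)
      (by simp [hs.n]) hB.n_le (by simp [hi]) (by simp) trivial (fun _ _ _ _ => trivial)
      fun u' lu y _ => ?_).congr (by simp [writeValues])
    simp only [update_idem]
    set s₁ := update (update s acc y) i (rep u') with hs₁
    have c₁ : Clean n d s₁ := (hs.update _ rfl).update _ rfl
    refine (runs_forLoop_update (R := acc) (fun a y =>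
      if entryAt n d (s tab) u' a u' a then false :: (rep a ++ y) else y) (fun _ => True)
      c₁.d hB.d_le (by simp [hs₁, hj]) (by simp) trivial (fun _ _ _ _ => trivial)
      fun a' la z _ => ?_).congr (by simp [hs₁])
    set s₂ := update (update s₁ acc z) j (rep a') with hs₂
    have c₂ : Clean n d s₂ := (c₁.update _ rfl).update _ rfl
    refine runs_testEntry hB c₂ (by simpa [hs₁, hs₂] using hT) rfl rfl rfl
      (u' := u') (by simp [hs₁, hs₂]) (a' := a') (by simp [hs₂]) (by simp [hs₁, hs₂])
      (by simp [hs₂]) lu la lu la ?_ ?_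
    · intro h1
      have := hB.d_le
      refine (runs_add (by simp [hs₂]; omega)).seq ((Runs.push _ _ _).congr ?_)
      simp [hs₁, hs₂] at h1
      simp [h1, hs₂]
    · intro h1
      refine (Runs.skip _).congr ?_
      simp [hs₁, hs₂] at h1
      have : s₂ acc = z := by simp [hs₂]
      simp [h1, ← this]
  refine r1.seq (r2.seq ((runs_loop_shift (by simp) (by simp) hl (by simp)).congr ?_))
  ext1 k
  simp only [update_apply]
  split_ifs <;> simp_all

/-- The program that finds a solution. -/
def solveProg : StackProg Reg :=
  parseUnary inp .n g ;; parseUnary inp .d g ;; allocProg ;; readUnaryProg ;; readBinaryProg ;;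
  closureProg ;; hasValuesProg ;;
  ite f (clear f ;; searchProg ;; outputProg) (push out false) ;;
  clear tab ;; clear .n ;; clear .d

lemma runs_solveProg (hB : SizeBound n d B) {bits T₀ : List Bool}
    (hlen : n + 1 + (d + 1 + bits.length) ≤ B)
    (hread : readBinary n d (readUnary n d (bits, List.replicate (n * d * n * d) false)) = ([], T₀))
    (hout : (writeValues n d (searchTable n d (closure3 n d T₀)) [true]).length ≤ B) :
    Runs B solveProg (update (fun _ => []) inp (rep n ++ false :: (rep d ++ false :: bits)))
      (update (fun _ => []) out (if hasValues n d (closure3 n d T₀) then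
        (writeValues n d (searchTable n d (closure3 n d T₀)) [true]).reverse else [false])) := by
  have hBn := hB.n_le
  have hBd := hB.d_le
  have r1 := runs_parseUnary (B := B)
    (s := update (fun _ => []) inp (rep n ++ false :: (rep d ++ false :: bits)))
    (A := inp) (k := .n) (g := g) (N := n) (r := rep d ++ false :: bits) (by simp) (by simp)
    (by simp) (by simp) (by simp) (by simp) (by simp; omega)
  have r2 := runs_parseUnary (B := B)
    (s := update (update (update (fun _ => []) inp (rep n ++ false :: (rep d ++ false :: bits))) inp
      (rep d ++ false :: bits)) .n (rep n))
    (A := inp) (k := .d) (g := g) (N := d) (r := bits) (by simp) (by simp)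
    (by simp) (by simp) (by simp) (by simp) (by simp; omega)
  set base : Reg → List Bool := update (update (fun _ => []) .n (rep n)) .d (rep d) with hbase
  have e2 : update (update (update (update (update (fun _ => []) inp
      (rep n ++ false :: (rep d ++ false :: bits))) inp (rep d ++ false :: bits)) .n (rep n)) inp
      bits) .d (rep d) = update base inp bits := by
    ext1 k
    simp only [hbase, update_apply]
    split_ifs <;> simp_all
  rw [e2] at r2
  have cb : Clean n d base := by constructor <;> simp [hbase]
  have kb : SweepReady base := by constructor <;> simp [hbase]
  have r3 := runs_allocProg (s := update base inp bits) hB (cb.update _ rfl) (by simp [hbase])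
  set T := List.replicate (n * d * n * d) false with hT
  have e3 : update (update base inp bits) tab T = setIO base (bits, T) := rfl
  rw [e3] at r3
  have r4 := runs_readUnaryProg (s := setIO base (bits, T)) hB (Clean.setIO cb _)
    (by simp [hT]) (by simp [setIO, hbase]) (by simp [setIO, hbase])
  simp only [setIO_setIO, setIO_inp, setIO_tab] at r4
  have r5 := runs_readBinaryProg (s := setIO base (readUnary n d (bits, T))) hB (Clean.setIO cb _)
    (by simp [hT]) (by simp [setIO, hbase]) (by simp [setIO, hbase]) (by simp [setIO, hbase])
    (by simp [setIO, hbase]) (by simp [setIO, hbase])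
  simp only [setIO_setIO, setIO_inp, setIO_tab, Prod.mk.eta, hread] at r5
  have hT₀ : T₀.length = n * d * n * d := by
    have h1 : (readBinary n d (readUnary n d (bits, T))).2.length = n * d * n * d := by
      rw [show n * d * n * d = (readUnary n d (bits, T)).2.length by simp [hT]]
      exact iter_length_snd (fun _ _ => iter_length_snd (fun _ _ => iter_length_snd (fun _ _ =>
        iter_length_snd (fun _ _ => readEntry_length ..) _ _) _ _) _ _) _ _
    rwa [hread] at h1
  have e5 : setIO base ([], T₀) = update base tab T₀ := by
    have : base inp = [] := by simp [hbase]
    simp [setIO, ← this]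
  rw [e5] at r5
  have r6 := runs_closureProg (s := update base tab T₀) hB (cb.update _ rfl)
    (kb.update _ (by simp)) (by simpa using hT₀)
  simp only [update_self, update_idem] at r6
  set T₁ := closure3 n d T₀ with hT₁
  have hT₁l : T₁.length = n * d * n * d := by simp [hT₁, hT₀]
  have c₁ : Clean n d (update base tab T₁) := cb.update _ rfl
  have k₁ : SweepReady (update base tab T₁) := kb.update _ (by simp)
  have r7 := runs_hasValuesProg (s := update base tab T₁) hB c₁ k₁ (by simp [hbase])
    (by simpa using hT₁l)
  simp only [update_self] at r7
  have hf : update (update base tab T₁) f [] = update base tab T₁ := by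
    have : (update base tab T₁) f = [] := by simp [hbase]
    simp [← this]
  have r8 : ∃ T₂ : List Bool, T₂.length = n * d * n * d ∧
      Runs B (ite f (clear f ;; searchProg ;; outputProg) (push out false))
      (update (update base tab T₁) f (if hasValues n d T₁ then [true] else []))
      (update (update base tab T₂) out (if hasValues n d T₁ then
        (writeValues n d (searchTable n d T₁) [true]).reverse else [false])) := by
    cases hv : hasValues n d T₁
    · refine ⟨T₁, hT₁l, Runs.iteFalse _ (by simp) ((Runs.push _ _ _).congr ?_)⟩
      simp only [Bool.false_eq_true, if_false, hf]
      simp [hbase]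
    · have r9 := runs_searchProg (s := update base tab T₁) hB c₁ k₁ (by simp [hbase])
        (by simp [hbase]) (by simpa using hT₁l) (by simp [hbase]) (by simp [hbase])
      simp only [update_self, update_idem] at r9
      have hl : (searchTable n d T₁).length = n * d * n * d := by
        rw [← hT₁l]
        exact iter_length (fun _ _ => iter_length (fun _ _ => tryDelete_length ..) _ _) _ _
      have r10 := runs_outputProg (s := update base tab (searchTable n d T₁)) hB (cb.update _ rfl)
        (by simpa using hl) (by simp [hbase]) (by simp [hbase]) (by simp [hbase])
        (by simp [hbase]) (by simpa using hout)
      simp only [update_self] at r10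
      refine ⟨_, hl, Runs.iteTrue _ (by simp) (Runs.seq ((runs_clear (by
        simpa using hB.one)).congr ?_) (r9.seq r10))⟩
      simp only [update_idem, hf]
  obtain ⟨T₂, hT₂, r8⟩ := r8
  refine r1.seq (r2.seq (r3.seq (r4.seq (r5.seq (r6.seq (r7.seq (r8.seq
    ((runs_clear ?_).seq ((runs_clear ?_).seq ((runs_clear ?_).congr ?_))))))))))
  · simpa [hT₂] using hB.ndnd
  · simp [hbase, hBn]
  · simp [hbase, hBd]
  · ext1 k
    simp only [hbase, update_apply]
    split_ifs <;> simp_all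

end TableProg

/-! ### Correctness of the closure and of the search -/

lemma mul_add_inj {x x' z z' w : ℕ} (hz : z < w) (hz' : z' < w) (h : x * w + z = x' * w + z') :
    x = x' ∧ z = z' := by
  have hw : 0 < w := by omega
  have h1 := congrArg (· / w) h
  have h2 := congrArg (· % w) h
  simp only [mul_comm _ w, Nat.mul_add_div hw, Nat.mul_add_mod, Nat.div_eq_of_lt hz,
    Nat.div_eq_of_lt hz', Nat.mod_eq_of_lt hz, Nat.mod_eq_of_lt hz'] at h1 h2
  exact ⟨by omega, h2⟩

lemma entryIx_inj {n d u a v b u' a' v' b' : ℕ} (ha : a < d) (hv : v < n) (hb : b < d)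
    (ha' : a' < d) (hv' : v' < n) (hb' : b' < d)
    (h : entryIx n d u a v b = entryIx n d u' a' v' b') : u = u' ∧ a = a' ∧ v = v' ∧ b = b' := by
  unfold entryIx at h
  obtain ⟨h₁, rfl⟩ := mul_add_inj hb hb' h
  obtain ⟨h₂, rfl⟩ := mul_add_inj hv hv' h₁
  obtain ⟨rfl, rfl⟩ := mul_add_inj ha ha' h₂
  exact ⟨rfl, rfl, rfl, rfl⟩

/-- Every entry allowed by `T` is allowed by `T'`. -/
def SubTable (T T' : List Bool) : Prop := ∀ k, T.getD k false = true → T'.getD k false = true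

lemma SubTable.refl (T : List Bool) : SubTable T T := fun _ h => h

lemma SubTable.trans {T T' T'' : List Bool} (h : SubTable T T') (h' : SubTable T' T'') : SubTable T T'' :=
  fun k hk => h' k (h k hk)

lemma getD_set_false (T : List Bool) (k l : ℕ) :
    (T.set k false).getD l false = if k = l then false else T.getD l false := by
  by_cases h : k = l
  · subst h
    by_cases hk : k < T.length <;> simp [List.getD_eq_getElem?_getD, hk]
  · simp [List.getD_eq_getElem?_getD, h]

lemma sub_set_false (T : List Bool) (k : ℕ) : SubTable (T.set k false) T := by
  intro l hl
  rw [getD_set_false] at hl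
  split_ifs at hl
  exact hl

lemma sub_iter {F : ℕ → List Bool → List Bool} (h : ∀ j T, SubTable (F j T) T) (T : List Bool) (N : ℕ) :
    SubTable (iter F T N) T :=
  iter_induction (fun T' => SubTable T' T) N (SubTable.refl T) fun j _ y hy => (h j y).trans hy

lemma sub_revise (n d u a v b w : ℕ) (T : List Bool) : SubTable (revise n d u a v b w T) T := by
  unfold revise
  split_ifs
  · exact SubTable.refl T
  · exact sub_set_false T _

lemma sub_closure3 (n d : ℕ) (T : List Bool) : SubTable (closure3 n d T) T :=
  sub_iter (fun _ _ => sub_iter (fun _ _ => sub_iter (fun _ _ => sub_iter (fun _ _ => sub_iter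
    (fun _ _ => sub_iter (fun _ _ => sub_revise _ _ _ _ _ _ _ _) _ _) _ _) _ _) _ _) _ _) _ _

lemma sub_tryDelete (n d u a : ℕ) (T : List Bool) : SubTable (tryDelete n d u a T) T := by
  unfold tryDelete
  split_ifs
  · exact (sub_closure3 _ _ _).trans (sub_set_false _ _)
  · exact SubTable.refl T

/-- `f` either fixes a table or decreases the number of allowed entries. -/
def Shrinks (f : List Bool → List Bool) : Prop :=
  ∀ T, f T = T ∨ (f T).count true < T.count true

lemma shrinks_iter {F : ℕ → List Bool → List Bool} (h : ∀ j, Shrinks (F j)) (N : ℕ) :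
    Shrinks (fun T => iter F T N) ∧ ∀ T, iter F T N = T → ∀ j < N, F j T = T := by
  induction N with
  | zero => exact ⟨fun T => Or.inl rfl, fun T _ j hj => by omega⟩
  | succ N ih =>
    obtain ⟨ih₁, ih₂⟩ := ih
    constructor
    · intro T
      rcases ih₁ T with h1 | h1
      · simp only [iter] at h1 ⊢
        rw [h1]
        exact h N T
      · simp only [iter] at h1 ⊢
        rcases h N (iter F T N) with h2 | h2
        · rw [h2]; exact Or.inr h1
        · exact Or.inr (h2.trans h1)
    · intro T hT j hj
      simp only [iter] at hT
      rcases ih₁ T with h1 | h1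
      · simp only at h1
        rcases Nat.lt_succ_iff_lt_or_eq.mp hj with hj | rfl
        · exact ih₂ T h1 j hj
        · rwa [h1] at hT
      · simp only at h1
        exfalso
        rcases h N (iter F T N) with h2 | h2
        · rw [h2] at hT
          rw [hT] at h1
          omega
        · rw [hT] at h2
          omega

lemma iter_fixed {f : List Bool → List Bool} (h : Shrinks f) {N : ℕ} {T : List Bool}
    (hN : T.count true ≤ N) : f (iter (fun _ => f) T N) = iter (fun _ => f) T N := by
  have key : ∀ N, f (iter (fun _ => f) T N) = iter (fun _ => f) T N ∨
      (iter (fun _ => f) T (N + 1)).count true + (N + 1) ≤ T.count true := by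
    intro N
    induction N with
    | zero =>
      rcases h T with h1 | h1
      · exact Or.inl h1
      · right; simp only [iter]; omega
    | succ N ih =>
      rcases ih with ih | ih
      · left; simp only [iter]; rw [ih, ih]
      · rcases h (iter (fun _ => f) T (N + 1)) with h1 | h1
        · exact Or.inl h1
        · right; simp only [iter] at h1 ih ⊢; omega
  rcases key N with h | h
  · exact h
  · omega

lemma shrinks_set_false (k : ℕ) : Shrinks (fun T => T.set k false) := by
  intro T
  dsimp only
  induction T generalizing k with
  | nil => left; rfl
  | cons b T ih =>
    cases k with
    | zero => cases b <;> simp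
    | succ k =>
      rcases ih k with h | h
      · left; simp [h]
      · right; simpa [List.count_cons] using h

lemma shrinks_revise (n d u a v b w : ℕ) : Shrinks (revise n d u a v b w) := by
  intro T
  unfold revise
  split_ifs
  · exact Or.inl rfl
  · exact shrinks_set_false _ T

/-- The table is path consistent. -/
def Closed (n d : ℕ) (T : List Bool) : Prop :=
  ∀ u < n, ∀ a < d, ∀ v < n, ∀ b < d, ∀ w < n, entryAt n d T u a v b = true →
    ∃ c < d, entryAt n d T u a w c = true ∧ entryAt n d T w c v b = true

lemma closed_closure3 (n d : ℕ) (T : List Bool) : Closed n d (closure3 n d T) := by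
  have s1 (u a v b : ℕ) := shrinks_iter (F := fun w T => revise n d u a v b w T)
    (fun w => shrinks_revise n d u a v b w) n
  have s2 (u a v : ℕ) := shrinks_iter (F := fun b T => iter (fun w T => revise n d u a v b w T) T n)
    (fun b => (s1 u a v b).1) d
  have s3 (u a : ℕ) := shrinks_iter (F := fun v T => iter (fun b T => iter (fun w T =>
    revise n d u a v b w T) T n) T d) (fun v => (s2 u a v).1) n
  have s4 (u : ℕ) := shrinks_iter (F := fun a T => iter (fun v T => iter (fun b T => iter
    (fun w T => revise n d u a v b w T) T n) T d) T n) (fun a => (s3 u a).1) d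
  have s5 := shrinks_iter (F := fun u T => iter (fun a T => iter (fun v T => iter (fun b T => iter
    (fun w T => revise n d u a v b w T) T n) T d) T n) T d) (fun u => (s4 u).1) n
  have hfix : sweep n d (closure3 n d T) = closure3 n d T :=
    iter_fixed (f := sweep n d) s5.1 List.count_le_length
  intro u hu a ha v hv b hb w hw h
  have h1 := s5.2 _ hfix u hu
  have h2 := (s4 u).2 _ h1 a ha
  have h3 := (s3 u a).2 _ h2 v hv
  have h4 := (s2 u a v).2 _ h3 b hb
  have h5 := (s1 u a v b).2 _ h4 w hw
  simp only [revise] at h5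
  split_ifs at h5 with h6
  · simpa [supported] using h6
  · rw [entryAt, ← h5, getD_set_false] at h
    simp at h

/-- The assignment `s` is allowed by the table. -/
def Sol (n d : ℕ) (T : List Bool) (s : ℕ → ℕ) : Prop :=
  (∀ u < n, s u < d) ∧ ∀ u < n, ∀ v < n, entryAt n d T u (s u) v (s v) = true

variable {n d : ℕ} {T T' : List Bool} {s : ℕ → ℕ}

lemma Sol.mono (h : Sol n d T s) (hT : SubTable T T') : Sol n d T' s :=
  ⟨h.1, fun u hu v hv => hT _ (h.2 u hu v hv)⟩

lemma Sol.set_false (h : Sol n d T s) {u a v b : ℕ} (ha : a < d) (hv : v < n) (hb : b < d)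
    (hne : ¬ (a = s u ∧ b = s v)) : Sol n d (T.set (entryIx n d u a v b) false) s := by
  refine ⟨h.1, fun u' hu' v' hv' => ?_⟩
  rw [entryAt, getD_set_false, if_neg]
  · exact h.2 u' hu' v' hv'
  · intro he
    obtain ⟨rfl, rfl, rfl, rfl⟩ := entryIx_inj ha hv hb (h.1 u' hu') hv' (h.1 v' hv') he
    exact hne ⟨rfl, rfl⟩

lemma Sol.revise (h : Sol n d T s) {u a v b w : ℕ} (hu : u < n) (ha : a < d) (hv : v < n)
    (hb : b < d) (hw : w < n) : Sol n d (revise n d u a v b w T) s := by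
  unfold _root_.revise
  split_ifs with hs
  · exact h
  · refine h.set_false ha hv hb ?_
    rintro ⟨rfl, rfl⟩
    apply hs
    simp only [supported, List.any_eq_true, List.mem_range, Bool.and_eq_true]
    exact ⟨s w, h.1 w hw, h.2 u hu w hw, h.2 w hw v hv⟩

lemma Sol.closure3 (h : Sol n d T s) : Sol n d (closure3 n d T) s :=
  iter_induction (fun T => Sol n d T s) _ h fun _ _ _ h =>
  iter_induction (fun T => Sol n d T s) _ h fun _ hu _ h =>
  iter_induction (fun T => Sol n d T s) _ h fun _ ha _ h =>
  iter_induction (fun T => Sol n d T s) _ h fun _ hv _ h =>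
  iter_induction (fun T => Sol n d T s) _ h fun _ hb _ h =>
  iter_induction (fun T => Sol n d T s) _ h fun _ hw _ h => h.revise hu ha hv hb hw

lemma Sol.hasValues (h : Sol n d T s) : hasValues n d T = true := by
  simp only [_root_.hasValues, List.all_eq_true, List.any_eq_true, List.mem_range]
  exact fun w hw => ⟨s w, h.1 w hw, h.2 w hw w hw⟩

/-- The invariant of the search in the table `T₀`. -/
structure SearchInv (n d : ℕ) (T₀ T : List Bool) : Prop where
  closed : Closed n d T
  hasValues : hasValues n d T = true
  sub : SubTable T T₀
  sol : ∀ s, Sol n d T₀ s → (∀ u < n, entryAt n d T u (s u) u (s u) = true) → Sol n d T s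

lemma SearchInv.closure3 {T₀ : List Bool} (h : _root_.hasValues n d (closure3 n d T₀) = true) :
    SearchInv n d T₀ (closure3 n d T₀) :=
  ⟨closed_closure3 _ _ _, h, sub_closure3 _ _ _, fun _ hs _ => hs.closure3⟩

lemma SearchInv.tryDelete {T₀ : List Bool} (h : SearchInv n d T₀ T) {u a : ℕ} (hu : u < n)
    (ha : a < d) : SearchInv n d T₀ (tryDelete n d u a T) := by
  unfold _root_.tryDelete
  split_ifs with hv
  · refine ⟨closed_closure3 _ _ _, hv, ((sub_closure3 _ _ _).trans (sub_set_false _ _)).trans h.sub,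
      fun s hs hd => Sol.closure3 (Sol.set_false ?_ ha hu ha ?_)⟩
    · exact h.sol s hs fun u' hu' => ((sub_closure3 _ _ _).trans (sub_set_false _ _)) _ (hd u' hu')
    · rintro ⟨rfl, -⟩
      have := sub_closure3 _ _ _ _ (hd u hu)
      rw [getD_set_false] at this
      simp at this
  · exact h

lemma iter_stage {F : ℕ → List Bool → List Bool} (h : ∀ j T, SubTable (F j T) T) (I : List Bool → Prop)
    {N : ℕ} (hT : I T) (hI : ∀ j < N, ∀ T, I T → I (F j T)) {j : ℕ} (hj : j < N) :
    ∃ y, I y ∧ SubTable (iter F T N) (F j y) := by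
  induction N with
  | zero => omega
  | succ N ih =>
    rcases Nat.lt_succ_iff_lt_or_eq.mp hj with hj | rfl
    · obtain ⟨y, hy, hs⟩ := ih (fun j hj => hI j (by omega)) hj
      exact ⟨y, hy, (h N _).trans hs⟩
    · exact ⟨iter F T j, iter_induction I j hT fun i hi => hI i (by omega), SubTable.refl _⟩

theorem searchTable_spec {T₀ : List Bool} (h : SearchInv n d T₀ T)
    (hex : ∀ T, SearchInv n d T₀ T → ∃ s, Sol n d T₀ s ∧
      ∀ u < n, entryAt n d T u (s u) u (s u) = true) :
    ∃ s, Sol n d T₀ s ∧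
      ∀ u < n, ∀ a < d, entryAt n d (searchTable n d T) u a u a = true ↔ a = s u := by
  have hinner (u : ℕ) (hu : u < n) (T : List Bool) (h : SearchInv n d T₀ T) :
      SearchInv n d T₀ (iter (fun a T => tryDelete n d u a T) T d) :=
    iter_induction (SearchInv n d T₀) _ h fun a ha T h => h.tryDelete hu ha
  have hinv : SearchInv n d T₀ (searchTable n d T) :=
    iter_induction (SearchInv n d T₀) _ h hinner
  obtain ⟨s, hs₀, hsd⟩ := hex _ hinv
  have hs := hinv.sol s hs₀ hsd
  refine ⟨s, hs₀, fun u hu a ha => ⟨fun he => ?_, ?_⟩⟩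
  · obtain ⟨T₁, h₁, hsub₁⟩ := iter_stage (T := T)
      (F := fun u T => iter (fun a T => tryDelete n d u a T) T d)
      (fun _ _ => sub_iter (fun _ _ => sub_tryDelete _ _ _ _ _) _ _) (SearchInv n d T₀) h hinner hu
    obtain ⟨T₂, h₂, hsub₂⟩ := iter_stage (T := T₁) (F := fun a T => tryDelete n d u a T)
      (fun _ _ => sub_tryDelete _ _ _ _ _) (SearchInv n d T₀) h₁ (fun a ha T h => h.tryDelete hu ha) ha
    have hsub : SubTable (searchTable n d T) (tryDelete n d u a T₂) := hsub₁.trans hsub₂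
    by_contra hne
    have hsol : Sol n d (closure3 n d (T₂.set (entryIx n d u a u a) false)) s :=
      ((hs.mono (hsub.trans (sub_tryDelete _ _ _ _ _))).set_false ha hu ha fun h => hne h.1).closure3
    have := hsub _ he
    rw [tryDelete, if_pos hsol.hasValues] at this
    have := sub_closure3 _ _ _ _ this
    rw [getD_set_false] at this
    simp at this
  · rintro rfl
    exact hsd u hu

lemma writeValues_eq {N : ℕ} (hs : ∀ u < N, s u < d)
    (h : ∀ u < N, ∀ a < d, entryAt n d T u a u a = true ↔ a = s u) (y : List Bool) :
    iter (fun u y => iter (fun a y => if entryAt n d T u a u a then false :: (rep a ++ y) else y)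
      y d) y N = ((List.range N).flatMap fun u => rep (s u) ++ [false]).reverse ++ y := by
  induction N with
  | zero => rfl
  | succ N ih =>
    have hin : ∀ (D : ℕ) (y : List Bool), D ≤ d → iter (fun a y => if entryAt n d T N a N a then
        false :: (rep a ++ y) else y) y D = if s N < D then false :: (rep (s N) ++ y) else y := by
      intro D y hD
      induction D with
      | zero => rfl
      | succ D ihD =>
        rw [iter, ihD (by omega)]
        by_cases h1 : D = s N
        · rw [if_pos ((h N (by omega) D (by omega)).2 h1)]
          simp [h1]
        · rw [if_neg (fun h2 => h1 ((h N (by omega) D (by omega)).1 h2))]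
          have : s N < D ↔ s N < D + 1 := by omega
          simp only [this]
    rw [iter, ih (fun u hu => hs u (by omega)) (fun u hu => h u (by omega)), hin d _ le_rfl,
      if_pos (hs N (by omega)), List.range_succ]
    simp [rep]

lemma length_iter_le {F : ℕ → List Bool → List Bool} {c N : ℕ}
    (h : ∀ j < N, ∀ y, (F j y).length ≤ y.length + c) (y : List Bool) :
    (iter F y N).length ≤ y.length + N * c := by
  induction N with
  | zero => simp [iter]
  | succ N ih =>
    have := h N (by omega) (iter F y N)
    have := ih fun j hj => h j (by omega)
    rw [iter, Nat.succ_mul]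
    omega

lemma length_writeValues_le (n d : ℕ) (T y : List Bool) :
    (writeValues n d T y).length ≤ y.length + n * (d * d) := by
  refine length_iter_le (fun u _ y => length_iter_le (fun a ha y => ?_) y) y
  split_ifs
  · simp; omega
  · omega

/-! ### Reading the input -/

lemma iter_read {F : ℕ → List Bool × List Bool → List Bool × List Bool} {A : ℕ → List Bool}
    {G : ℕ → List Bool → List Bool} {N : ℕ}
    (h : ∀ j < N, ∀ r T, F j (A j ++ r, T) = (r, G j T)) (r T : List Bool) :
    iter F ((List.range N).flatMap A ++ r, T) N = (r, iter G T N) := by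
  induction N generalizing r with
  | zero => simp [iter]
  | succ N ih =>
    rw [iter, List.range_succ, List.flatMap_append, List.append_assoc,
      ih (fun j hj => h j (by omega))]
    simpa [iter] using h N (by omega) r (iter G T N)

/-- Store a bit for the assignments `⟨u, a⟩` and `⟨v, b⟩` in the table. -/
def storeEntry (n d u a v b : ℕ) (β : Bool) (T : List Bool) : List Bool :=
  if β then (T.set (entryIx n d u a v b) true).set (entryIx n d v b u a) true else T

lemma readEntry_cons (n d u a v b : ℕ) (β : Bool) (r T : List Bool) :
    readEntry n d u a v b ([β] ++ r, T) = (r, storeEntry n d u a v b β T) := by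
  simp [readEntry, storeEntry]

/-- Storing positions: after `f`, the true entries are the old ones and those at the positions
given by `W`. -/
def Stores (L : ℕ) (f : List Bool → List Bool) (W : ℕ → Prop) : Prop :=
  ∀ T, T.length = L → (f T).length = L ∧
    ∀ k, (f T).getD k false = true ↔ T.getD k false = true ∨ W k

lemma stores_iter {L N : ℕ} {G : ℕ → List Bool → List Bool} {W : ℕ → ℕ → Prop}
    (h : ∀ j < N, Stores L (G j) (W j)) :
    Stores L (fun T => iter G T N) (fun k => ∃ j < N, W j k) := by
  induction N with
  | zero => exact fun T hT => ⟨hT, fun k => by simp [iter]⟩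
  | succ N ih =>
    intro T hT
    obtain ⟨h1, h2⟩ := ih (fun j hj => h j (by omega)) T hT
    obtain ⟨h3, h4⟩ := h N (by omega) _ h1
    refine ⟨h3, fun k => ?_⟩
    simp only [iter]
    rw [h4, h2]
    constructor
    · rintro ((h | ⟨j, hj, h⟩) | h)
      · exact Or.inl h
      · exact Or.inr ⟨j, by omega, h⟩
      · exact Or.inr ⟨N, by omega, h⟩
    · rintro (h | ⟨j, hj, h'⟩)
      · exact Or.inl (Or.inl h)
      · rcases Nat.lt_succ_iff_lt_or_eq.mp hj with hj | rfl
        · exact Or.inl (Or.inr ⟨j, hj, h'⟩)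
        · exact Or.inr h'

lemma getD_set_true (T : List Bool) {k : ℕ} (l : ℕ) (hk : k < T.length) :
    (T.set k true).getD l false = true ↔ T.getD l false = true ∨ l = k := by
  by_cases h : k = l
  · subst h
    simp [List.getD_eq_getElem?_getD, hk]
  · simp [List.getD_eq_getElem?_getD, h, Ne.symm h]

lemma stores_storeEntry {n d u a v b : ℕ} (hu : u < n) (ha : a < d) (hv : v < n) (hb : b < d)
    (β : Bool) : Stores (n * d * n * d) (storeEntry n d u a v b β)
      (fun k => β = true ∧ (k = entryIx n d u a v b ∨ k = entryIx n d v b u a)) := by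
  intro T hT
  unfold storeEntry
  cases β
  · simpa using hT
  · refine ⟨by simpa using hT, fun k => ?_⟩
    simp only [if_true]
    rw [getD_set_true _ _ (by simpa [hT] using entryIx_lt hv hb hu ha),
      getD_set_true _ _ (by simpa [hT] using entryIx_lt hu ha hv hb)]
    simp only [true_and, or_assoc]

/-- The bits of the unary constraints. -/
def unaryBits (n d : ℕ) (c : ℕ → ℕ → ℕ → ℕ → Bool) : List Bool :=
  (List.range n).flatMap fun u => (List.range d).flatMap fun a => [c u a u a]

/-- The bits of the binary constraints. -/
def binaryBits (n d : ℕ) (c : ℕ → ℕ → ℕ → ℕ → Bool) : List Bool :=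
  (List.range n).flatMap fun u => (List.range (n - u - 1)).flatMap fun k =>
    (List.range d).flatMap fun a => (List.range d).flatMap fun b => [c u a (u + 1 + k) b]

theorem readBinary_readUnary (n d : ℕ) (c : ℕ → ℕ → ℕ → ℕ → Bool)
    (hc : ∀ u a v b, c u a v b = c v b u a) (hd : ∀ u a b, c u a u b = true → a = b) :
    ∃ T₀, readBinary n d (readUnary n d
        (unaryBits n d c ++ binaryBits n d c, List.replicate (n * d * n * d) false)) = ([], T₀) ∧
      ∀ u < n, ∀ a < d, ∀ v < n, ∀ b < d, entryAt n d T₀ u a v b = c u a v b := by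
  set T := List.replicate (n * d * n * d) false with hT
  have hlen : T.length = n * d * n * d := by simp [hT]
  set GU : List Bool → List Bool := fun T => iter (fun u T => iter (fun a T =>
    storeEntry n d u a u a (c u a u a) T) T d) T n
  set GB : List Bool → List Bool := fun T => iter (fun u T => iter (fun k T => iter (fun a T =>
    iter (fun b T => storeEntry n d u a (u + 1 + k) b (c u a (u + 1 + k) b) T) T d) T d) T
      (n - u - 1)) T n
  have h1 (r T : List Bool) : readUnary n d (unaryBits n d c ++ r, T) = (r, GU T) :=
    iter_read (fun u _ r T => iter_read (fun a _ r T => readEntry_cons ..) r T) r T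
  have h2 (r T : List Bool) : readBinary n d (binaryBits n d c ++ r, T) = (r, GB T) :=
    iter_read (fun u _ r T => iter_read (fun k _ r T => iter_read (fun a _ r T =>
      iter_read (fun b _ r T => readEntry_cons ..) r T) r T) r T) r T
  have s1 : Stores (n * d * n * d) GU _ :=
    stores_iter fun u hu => stores_iter fun a ha => stores_storeEntry hu ha hu ha _
  have s2 : Stores (n * d * n * d) GB _ :=
    stores_iter fun u hu => stores_iter fun k hk => stores_iter fun a ha => stores_iter fun b hb =>
      stores_storeEntry hu ha (show u + 1 + k < n by omega) hb _
  refine ⟨GB (GU T), ?_, fun u hu a ha v hv b hb => ?_⟩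
  · rw [h1, ← List.append_nil (binaryBits n d c), h2]
  · rw [Bool.eq_iff_iff, entryAt, (s2 _ (s1 _ hlen).1).2, (s1 _ hlen).2]
    have hfalse : ¬ T.getD (entryIx n d u a v b) false = true := by
      simp [hT, List.getD_eq_getElem?_getD, List.getElem?_replicate]
      split_ifs <;> simp
    constructor
    · rintro ((h | ⟨u', hu', a', ha', hcc, h⟩) | ⟨u', hu', k', hk', a', ha', b', hb', hcc, h⟩)
      · exact absurd h hfalse
      · rw [or_self] at h
        obtain ⟨rfl, rfl, rfl, rfl⟩ := entryIx_inj ha hv hb ha' hu' ha' h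
        exact hcc
      · rcases h with h | h
        · obtain ⟨rfl, rfl, rfl, rfl⟩ := entryIx_inj ha hv hb ha' (by omega) hb' h
          exact hcc
        · obtain ⟨rfl, rfl, rfl, rfl⟩ := entryIx_inj ha hv hb hb' hu' ha' h
          rw [hc]
          exact hcc
    · intro hcc
      rcases lt_trichotomy u v with h | rfl | h
      · refine Or.inr ⟨u, hu, v - u - 1, by omega, a, ha, b, hb, ?_⟩
        rw [show u + 1 + (v - u - 1) = v by omega]
        exact ⟨hcc, Or.inl rfl⟩
      · obtain rfl := hd u a b hcc
        exact Or.inl (Or.inr ⟨u, hu, a, ha, hcc, Or.inl rfl⟩)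
      · refine Or.inr ⟨v, hv, u - v - 1, by omega, b, hb, a, ha, ?_⟩
        rw [show v + 1 + (u - v - 1) = u by omega]
        exact ⟨by rw [hc]; exact hcc, Or.inr rfl⟩

/-! ### Path consistency decides instances with few conflicts -/

section Consistency

open Finset Classical

variable {V D : Type}

/-- The variables of `W` with a remaining value that conflicts with the value `a` of `q`; the
remaining values of `v` are the `b` with `R v b v b`. -/
noncomputable def valueConflicts (R E : V → D → V → D → Prop) (W : Finset V) (q : V) (a : D) :
    Finset V :=
  W.filter fun v => v ≠ q ∧ ∃ b, R v b v b ∧ ¬ E q a v b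

/-- The variables of `W` that are constrained with `q`. -/
noncomputable def neighbours (R E : V → D → V → D → Prop) (W : Finset V) (q : V) : Finset V :=
  W.filter fun v => ∃ a, R q a q a ∧ v ∈ valueConflicts R E W q a

/-- Each variable has at most two neighbours, or each of its values conflicts with at most one
variable. -/
def FewConflicts (R E : V → D → V → D → Prop) (W : Finset V) : Prop :=
  ∀ q ∈ W, #(neighbours R E W q) ≤ 2 ∨ ∀ a, R q a q a → #(valueConflicts R E W q a) ≤ 1

lemma mem_valueConflicts {R E : V → D → V → D → Prop} {W : Finset V} {q v : V} {a : D} :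
    v ∈ valueConflicts R E W q a ↔ v ∈ W ∧ v ≠ q ∧ ∃ b, R v b v b ∧ ¬ E q a v b := by
  simp [valueConflicts]

lemma mem_neighbours {R E : V → D → V → D → Prop} {W : Finset V} {q v : V} :
    v ∈ neighbours R E W q ↔ v ∈ W ∧ v ≠ q ∧ ∃ a b, R q a q a ∧ R v b v b ∧ ¬ E q a v b := by
  simp only [neighbours, mem_filter, mem_valueConflicts]
  constructor
  · rintro ⟨h, a, ha, -, hne, b, hb⟩
    exact ⟨h, hne, a, b, ha, hb⟩
  · rintro ⟨h, hne, a, b, ha, hb⟩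
    exact ⟨h, a, ha, h, hne, b, hb⟩

/-- Each vertex of a graph of minimal degree at least two can be assigned one of its edges in an
injective way. -/
lemma exists_pointing {W : Finset V} (N : V → Finset V)
    (h2 : ∀ q ∈ W, 2 ≤ #(N q)) :
    ∃ g : V → V, (∀ q ∈ W, g q ∈ N q) ∧ ∀ q ∈ W, ∀ q' ∈ W, g q = q' → g q' = q → q = q' := by
  let t : W → Finset (Sym2 V) := fun q => (N q).image fun v => s(q.1, v)
  have hcard (q : W) : 2 ≤ #(t q) := by
    rw [card_image_of_injective _ fun v v' h => Sym2.congr_right.1 h]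
    exact h2 q q.2
  have hall : ∀ S : Finset W, #S ≤ #(S.biUnion t) := by
    intro S
    have := card_mul_le_card_mul (s := S) (t := S.biUnion t) (m := 2) (n := 2)
      (fun q e => e ∈ t q) (fun q hq => ?_) (fun e _ => ?_)
    · omega
    · refine (hcard q).trans (card_le_card fun e he => ?_)
      simp only [bipartiteAbove, mem_filter, mem_biUnion]
      exact ⟨⟨q, hq, he⟩, he⟩
    · induction e with | _ x y => ?_
      refine (card_le_card_of_injOn (t := {x, y}) Subtype.val (fun q hq => ?_)
        Subtype.val_injective.injOn).trans card_le_two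
      simp only [bipartiteBelow, coe_filter, Set.mem_ofPred_eq, t, mem_image, Sym2.eq_iff] at hq
      obtain ⟨-, v, -, h | h⟩ := hq
      · simp [h.1]
      · simp [h.1]
  obtain ⟨f, hf, hft⟩ := (all_card_le_biUnion_card_iff_exists_injective t).1 hall
  have hg (q : W) : ∃ v ∈ N q, s(q.1, v) = f q := by simpa [t] using hft q
  choose g hg1 hg2 using hg
  refine ⟨fun q => if hq : q ∈ W then g ⟨q, hq⟩ else q, fun q hq => ?_, fun q hq q' hq' h h' => ?_⟩
  · simpa [hq] using hg1 ⟨q, hq⟩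
  · simp only [hq, hq', dif_pos] at h h'
    have : f ⟨q, hq⟩ = f ⟨q', hq'⟩ := by
      rw [← hg2, ← hg2, h, h', Sym2.eq_swap]
    exact congrArg Subtype.val (hf this)

theorem exists_solution_of_fewConflicts [Nonempty D] (R : V → D → V → D → Prop)
    (W₀ : Finset V) (hdiag : ∀ u a b, R u a u b → a = b)
    (hclosed : ∀ u ∈ W₀, ∀ a, ∀ v ∈ W₀, ∀ b, R u a v b → ∀ w ∈ W₀, ∃ c, R u a w c ∧ R w c v b)
    (hne : ∀ w ∈ W₀, ∃ c, R w c w c) (W : Finset V) :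
    ∀ E : V → D → V → D → Prop, W ⊆ W₀ → (∀ u a v b, E u a v b → E v b u a) →
      (∀ u ∈ W, ∀ a, ∀ v ∈ W, ∀ b, u ≠ v → R u a v b → E u a v b) → FewConflicts R E W →
      ∃ s : V → D, (∀ u ∈ W, R u (s u) u (s u)) ∧
        ∀ u ∈ W, ∀ v ∈ W, u ≠ v → E u (s u) v (s v) := by
  have hleft {u a v b} (hu : u ∈ W₀) (hv : v ∈ W₀) (h : R u a v b) : R u a u a := by
    obtain ⟨c, h1, -⟩ := hclosed u hu a v hv b h u hu
    obtain rfl := hdiag _ _ _ h1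
    exact h1
  have hright {u a v b} (hu : u ∈ W₀) (hv : v ∈ W₀) (h : R u a v b) : R v b v b := by
    obtain ⟨c, -, h1⟩ := hclosed u hu a v hv b h v hv
    obtain rfl := hdiag _ _ _ h1
    exact h1
  have hsupp {u a w} (hu : u ∈ W₀) (hw : w ∈ W₀) (h : R u a u a) :
      ∃ c, R u a w c ∧ R w c w c := by
    obtain ⟨c, h1, -⟩ := hclosed u hu a u hu a h w hw
    exact ⟨c, h1, hright hu hw h1⟩
  induction W using Finset.strongInduction with
  | H W ih =>
  intro E hW hsymm hRE hfew
  by_cases hp : ∃ p ∈ W, #(neighbours R E W p) ≤ 2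
  · obtain ⟨p, hpW, hp2⟩ := hp
    let E' : V → D → V → D → Prop := fun u a v b =>
      E u a v b ∧ ∃ c, R p c p c ∧ E u a p c ∧ E p c v b
    have hsub : W.erase p ⊆ W := erase_subset _ _
    have hpW₀ := hW hpW
    obtain ⟨s, hs1, hs2⟩ := ih (W.erase p) (erase_ssubset hpW) E' (hsub.trans hW)
      (fun u a v b ⟨h, c, h1, h2, h3⟩ => ⟨hsymm _ _ _ _ h, c, h1, hsymm _ _ _ _ h3,
        hsymm _ _ _ _ h2⟩)
      (fun u hu a v hv b huv h => by
        obtain ⟨hup, hu⟩ := mem_erase.1 hu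
        obtain ⟨hvp, hv⟩ := mem_erase.1 hv
        obtain ⟨c, h1, h2⟩ := hclosed u (hW hu) a v (hW hv) b h p hpW₀
        exact ⟨hRE u hu a v hv b huv h, c, hright (hW hu) hpW₀ h1,
          hRE u hu a p hpW c hup h1, hRE p hpW c v hv b hvp.symm h2⟩)
      (by
        intro q hq
        obtain ⟨hqp, hqW⟩ := mem_erase.1 hq
        obtain ⟨φ, hφ⟩ : ∃ φ : V → V, ∀ a, R q a q a →
            valueConflicts R E' (W.erase p) q a ⊆ (valueConflicts R E W q a).image φ := by
          obtain ⟨y, hy⟩ : ∃ y, q ∈ neighbours R E W p → neighbours R E W p ⊆ {q, y} := by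
            by_cases hqn : q ∈ neighbours R E W p
            · have hc : #((neighbours R E W p).erase q) ≤ 1 := by
                rw [card_erase_of_mem hqn]; omega
              have : Nonempty V := ⟨q⟩
              obtain ⟨y, hy⟩ := card_le_one_iff_subset_singleton.1 hc
              refine ⟨y, fun _ v hv => ?_⟩
              by_cases hvq : v = q
              · simp [hvq]
              · have := hy (mem_erase.2 ⟨hvq, hv⟩)
                simp only [mem_singleton] at this
                simp [this]
            · exact ⟨q, fun h => absurd h hqn⟩
          refine ⟨fun x => if x = p then y else x, fun a ha v hv => ?_⟩
          rw [mem_valueConflicts] at hv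
          obtain ⟨hv, hvq, b, hb, hnE⟩ := hv
          obtain ⟨hvp, hvW⟩ := mem_erase.1 hv
          rw [mem_image]
          by_cases hE : E q a v b
          · have hno : ¬ ∃ c, R p c p c ∧ E q a p c ∧ E p c v b := fun h => hnE ⟨hE, h⟩
            have h1 : ∃ c, R p c p c ∧ ¬ E q a p c := by
              by_contra hcon
              push Not at hcon
              obtain ⟨c, hc1, hc2⟩ := hsupp (hW hvW) hpW₀ hb
              exact hno ⟨c, hc2, hcon c hc2, hsymm _ _ _ _ (hRE v hvW b p hpW c hvp hc1)⟩
            have h2 : v ∈ neighbours R E W p := by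
              by_contra hcon
              rw [mem_neighbours] at hcon
              push Not at hcon
              obtain ⟨c, hc1, hc2⟩ := hsupp (hW hqW) hpW₀ ha
              exact hno ⟨c, hc2, hRE q hqW a p hpW c hqp hc1, hcon hvW hvp c b hc2 hb⟩
            obtain ⟨c, hc1, hc2⟩ := h1
            have h3 : q ∈ neighbours R E W p :=
              mem_neighbours.2 ⟨hqW, hqp, c, a, hc1, ha, fun h => hc2 (hsymm _ _ _ _ h)⟩
            have h4 := hy h3 h2
            simp only [mem_insert, mem_singleton, hvq, false_or] at h4
            exact ⟨p, mem_valueConflicts.2 ⟨hpW, hqp.symm, c, hc1, hc2⟩, by simp [h4]⟩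
          · exact ⟨v, mem_valueConflicts.2 ⟨hvW, hvq, b, hb, hE⟩, by simp [hvp]⟩
        have hφ' : neighbours R E' (W.erase p) q ⊆ (neighbours R E W q).image φ := by
          intro v hv
          simp only [neighbours, mem_filter] at hv
          obtain ⟨-, a, ha, hv⟩ := hv
          obtain ⟨x, hx, rfl⟩ := mem_image.1 (hφ a ha hv)
          refine mem_image_of_mem _ (mem_filter.2 ⟨?_, a, ha, hx⟩)
          exact (mem_valueConflicts.1 hx).1
        rcases hfew q hqW with h | h
        · exact Or.inl ((card_le_card hφ').trans (card_image_le.trans h))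
        · exact Or.inr fun a ha => (card_le_card (hφ a ha)).trans (card_image_le.trans (h a ha)))
    obtain ⟨c, hc1, hc2⟩ : ∃ c, R p c p c ∧ ∀ v ∈ neighbours R E W p, E p c v (s v) := by
      have hmem {v} (hv : v ∈ neighbours R E W p) : v ∈ W.erase p := by
        obtain ⟨h1, h2, -⟩ := mem_neighbours.1 hv
        exact mem_erase.2 ⟨h2, h1⟩
      interval_cases hcard : #(neighbours R E W p)
      · rw [card_eq_zero] at hcard
        obtain ⟨c, hc⟩ := hne p hpW₀
        exact ⟨c, hc, by simp [hcard]⟩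
      · obtain ⟨x, hx⟩ := card_eq_one.1 hcard
        have hxW := hmem (v := x) (by simp [hx])
        obtain ⟨hxp, hxW'⟩ := mem_erase.1 hxW
        obtain ⟨c, hc1, hc2⟩ := hsupp (hW hxW') hpW₀ (hs1 x hxW)
        refine ⟨c, hc2, ?_⟩
        simp only [hx, mem_singleton, forall_eq]
        exact hsymm _ _ _ _ (hRE x hxW' _ p hpW c hxp hc1)
      · obtain ⟨x, y, hxy, hxy'⟩ := card_eq_two.1 hcard
        obtain ⟨-, c, hc, h1, h2⟩ := hs2 x (hmem (by simp [hxy'])) y (hmem (by simp [hxy'])) hxy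
        refine ⟨c, hc, ?_⟩
        simp only [hxy', mem_insert, mem_singleton, forall_eq_or_imp, forall_eq]
        exact ⟨hsymm _ _ _ _ h1, h2⟩
    have hc3 : ∀ v ∈ W.erase p, E p c v (s v) := by
      intro v hv
      by_cases hvn : v ∈ neighbours R E W p
      · exact hc2 v hvn
      · rw [mem_neighbours] at hvn
        push Not at hvn
        exact hvn (hsub hv) (mem_erase.1 hv).1 c (s v) hc1 (hs1 v hv)
    refine ⟨Function.update s p c, fun u hu => ?_, fun u hu v hv huv => ?_⟩
    · by_cases hup : u = p
      · subst hup; simpa using hc1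
      · simpa [hup] using hs1 u (mem_erase.2 ⟨hup, hu⟩)
    · by_cases hup : u = p
      · subst hup
        simpa [huv.symm] using hc3 v (mem_erase.2 ⟨huv.symm, hv⟩)
      · by_cases hvp : v = p
        · subst hvp
          simpa [hup] using hsymm _ _ _ _ (hc3 u (mem_erase.2 ⟨hup, hu⟩))
        · simpa [hup, hvp] using
            (hs2 u (mem_erase.2 ⟨hup, hu⟩) v (mem_erase.2 ⟨hvp, hv⟩) huv).1
  · push Not at hp
    obtain ⟨g, hg1, hg2⟩ := exists_pointing (W := W) (neighbours R E W)
      (fun q hq => (hp q hq).le)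
    have hval (q : V) : ∃ a, q ∈ W → R q a q a ∧ g q ∈ valueConflicts R E W q a := by
      by_cases hq : q ∈ W
      · obtain ⟨-, a, ha⟩ := mem_filter.1 (hg1 q hq)
        exact ⟨a, fun _ => ha⟩
      · exact ⟨Classical.arbitrary D, fun h => absurd h hq⟩
    choose s hs using hval
    have hpt {u v} (hu : u ∈ W) (hv : v ∈ W) (huv : u ≠ v) (h : ¬ E u (s u) v (s v)) :
        g u = v := by
      have h1 : #(valueConflicts R E W u (s u)) ≤ 1 :=
        (hfew u hu).resolve_left (by have := hp u hu; omega) _ (hs u hu).1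
      exact card_le_one.1 h1 _ (hs u hu).2 _
        (mem_valueConflicts.2 ⟨hv, huv.symm, s v, (hs v hv).1, h⟩)
    refine ⟨s, fun u hu => (hs u hu).1, fun u hu v hv huv => ?_⟩
    by_contra h
    exact huv (hg2 u hu v hv (hpt hu hv huv h)
      (hpt hv hu huv.symm fun h' => h (hsymm _ _ _ _ h')))

end Consistency

/-! ### Occurrences of the pivot pattern -/

namespace BinaryCSP

/-- The assignments of `a` to `u` and of `b` to `v` are compatible. -/
def compat (P : BinaryCSP) (u : Fin P.n) (a : Fin P.d) (v : Fin P.n) (b : Fin P.d) : Bool :=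
  if h : u < v then P.binary u v h a b
  else if h : v < u then P.binary v u h b a
  else decide (a = b) && P.unary u a

lemma compat_of_lt (P : BinaryCSP) {u v : Fin P.n} (h : u < v) (a b : Fin P.d) :
    P.compat u a v b = P.binary u v h a b := by
  simp [compat, h]

lemma compat_self (P : BinaryCSP) (u : Fin P.n) (a b : Fin P.d) :
    P.compat u a u b = (decide (a = b) && P.unary u a) := by
  simp [compat]

lemma compat_comm (P : BinaryCSP) (u : Fin P.n) (a : Fin P.d) (v : Fin P.n) (b : Fin P.d) :
    P.compat u a v b = P.compat v b u a := by
  rcases lt_trichotomy u v with h | rfl | h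
  · simp [compat, h, h.le]
  · simp only [compat_self]
    by_cases hab : a = b
    · rw [hab]
    · simp [hab, Ne.symm hab]
  · simp [compat, h, h.le]

lemma isSolution_iff (P : BinaryCSP) (s : Fin P.n → Fin P.d) :
    P.toPattern.IsSolution s ↔ ∀ u v, P.compat u (s u) v (s v) = true := by
  have hT (b : Bool) : TV.ofBool b = TV.T ↔ b = true := by cases b <;> simp [TV.ofBool]
  constructor
  · intro h
    have key {u v : Fin P.n} (huv : u < v) : P.compat u (s u) v (s v) = true := by
      have := h _ (Or.inr ⟨u, v, huv, rfl⟩)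
      rwa [binaryConstraint, hT, ← P.compat_of_lt] at this
    intro u v
    rcases lt_trichotomy u v with huv | rfl | huv
    · exact key huv
    · have := h _ (Or.inl ⟨u, rfl⟩)
      rw [unaryConstraint, hT] at this
      simpa [compat_self] using this
    · rw [compat_comm]
      exact key huv
  · rintro h c (⟨v, rfl⟩ | ⟨u, v, huv, rfl⟩)
    · rw [unaryConstraint, hT]
      simpa [compat_self] using h v v
    · rw [binaryConstraint, hT, ← P.compat_of_lt]
      exact h u v

end BinaryCSP

open Classical in
lemma rename_nogood_rel {V D V' D' : Type} (s : V → V') (t : V → D → D') {p q : V} (hpq : p ≠ q)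
    (x y : D) (f : ((nogood p x q y).rename s t).scope → D') :
    ((nogood p x q y).rename s t).rel f =
      if f ⟨s p, Set.mem_image_of_mem s (by simp [nogood])⟩ = t p x ∧
        f ⟨s q, Set.mem_image_of_mem s (by simp [nogood])⟩ = t q y then TV.F else TV.U := by
  unfold ConstraintPattern.rename
  dsimp only
  rw [if_neg]
  · congr 1
    refine propext ⟨?_, fun h => ?_⟩
    · rintro ⟨l, hl, hF⟩
      have hxy : l ⟨p, by simp [nogood]⟩ = x ∧ l ⟨q, by simp [nogood]⟩ = y := by
        by_contra hne
        exact hne (by simpa [nogood] using hF)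
      rw [← hxy.1, ← hxy.2]
      exact ⟨hl ⟨p, _⟩, hl ⟨q, _⟩⟩
    · refine ⟨fun z => if z.1 = p then x else y, ?_, by simp [nogood, hpq.symm]⟩
      rintro ⟨z, hz⟩
      obtain rfl | rfl : z = p ∨ z = q := by simpa [nogood] using hz
      · simpa using h.1
      · simpa [hpq.symm] using h.2
  · rintro ⟨l, -, hT⟩
    simp only [nogood] at hT
    split_ifs at hT

namespace BinaryCSP

lemma realises_nogood_iff (P : BinaryCSP) {V D : Type} {s : V → Fin P.n} {t : V → D → Fin P.d}
    {p q : V} (hs : s p ≠ s q) (x y : D) :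
    (∃ c ∈ P.toPattern.constraints, c.Realises ((nogood p x q y).rename s t)) ↔
      P.compat (s p) (t p x) (s q) (t q y) = false := by
  have hpq : p ≠ q := fun h => hs (congrArg s h)
  have hscope : ((nogood p x q y).rename s t).scope = {s p, s q} := by
    simp [ConstraintPattern.rename, nogood, Set.image_pair]
  constructor
  · rintro ⟨c, hc, h, hle⟩
    have hle' := hle fun z => if z.1 = s p then t p x else t q y
    rw [rename_nogood_rel s t hpq] at hle'
    simp only [hs.symm, if_true, if_false, and_self] at hle'
    have hF : c.rel (fun z => if z.1 = s p then t p x else t q y) = TV.F := by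
      rcases hle' with h | h
      · cases h
      · exact h.symm
    rw [hscope] at h
    rcases hc with ⟨w, rfl⟩ | ⟨u, v, huv, rfl⟩
    · have h₁ : s p ∈ ({w} : Set (Fin P.n)) := by
        change s p ∈ (P.unaryConstraint w).scope
        rw [h]; simp
      have h₂ : s q ∈ ({w} : Set (Fin P.n)) := by
        change s q ∈ (P.unaryConstraint w).scope
        rw [h]; simp
      exact absurd (h₁.trans h₂.symm) hs
    · have hF' : P.binary u v huv (if u = s p then t p x else t q y)
          (if v = s p then t p x else t q y) = false := by
        revert hF
        simp only [binaryConstraint]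
        cases P.binary u v huv _ _ <;> simp [TV.ofBool]
      rw [← P.compat_of_lt] at hF'
      rcases Set.pair_eq_pair_iff.mp h with ⟨rfl, rfl⟩ | ⟨rfl, rfl⟩
      · simpa [hs.symm] using hF'
      · rw [compat_comm]
        simpa [hs.symm] using hF'
  · intro h
    rcases lt_or_gt_of_ne hs with hlt | hlt
    · refine ⟨_, Or.inr ⟨_, _, hlt, rfl⟩, show (P.binaryConstraint _ _ hlt).scope = _ from hscope.symm,
        fun f => ?_⟩
      rw [rename_nogood_rel s t hpq]
      split_ifs with hf
      · refine Or.inr ?_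
        exact (congrArg TV.ofBool ((congrArg₂ (P.binary _ _ hlt) hf.1 hf.2).trans
          ((P.compat_of_lt hlt _ _).symm.trans h))).symm
      · exact Or.inl rfl
    · refine ⟨_, Or.inr ⟨_, _, hlt, rfl⟩, show (P.binaryConstraint _ _ hlt).scope = _ from
        (hscope.trans (Set.pair_comm _ _)).symm, fun f => ?_⟩
      rw [rename_nogood_rel s t hpq]
      split_ifs with hf
      · refine Or.inr ?_
        exact (congrArg TV.ofBool ((congrArg₂ (P.binary _ _ hlt) hf.2 hf.1).trans
          ((P.compat_of_lt hlt _ _).symm.trans ((P.compat_comm _ _ _ _).trans h)))).symm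
      · exact Or.inl rfl

/-- The pattern `Pivot(1)` occurs in an instance exactly if some value of a variable `p` conflicts
with values of two other variables while some value of `p` conflicts with a value of a third. -/
theorem pivot_one_occursIn_iff (P : BinaryCSP) :
    (Pivot 1).OccursIn P.toPattern ↔ ∃ (p v w x : Fin P.n) (α β γ δ ε : Fin P.d),
      [p, v, w, x].Nodup ∧ P.compat p α v γ = false ∧ P.compat p α w δ = false ∧
        P.compat p β x ε = false := by
  constructor
  · rintro ⟨s, t, hst, h⟩
    have hs {y z : PivotVar 1} (hyz : y ≠ z) : s y ≠ s z :=
      hst.contextual (y, PivotVal.a) (z, PivotVal.a) hyz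
    refine ⟨s .p, s (.v 0), s (.w 0), s (.x 0), t .p .a, t .p .b, t (.v 0) .b, t (.w 0) .b,
      t (.x 0) .b, ?_, ?_, ?_, ?_⟩
    · simp [hs]
    · exact (P.realises_nogood_iff (hs (by simp)) _ _).mp (h _ (Or.inl ⟨0, rfl, Or.inl rfl⟩))
    · exact (P.realises_nogood_iff (hs (by simp)) _ _).mp
        (h _ (Or.inl ⟨0, rfl, Or.inr (Or.inl rfl)⟩))
    · exact (P.realises_nogood_iff (hs (by simp)) _ _).mp
        (h _ (Or.inl ⟨0, rfl, Or.inr (Or.inr rfl)⟩))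
  · rintro ⟨p, v, w, x, α, β, γ, δ, ε, hnd, h₁, h₂, h₃⟩
    simp only [List.nodup_cons, List.mem_cons, List.not_mem_nil, or_false, not_or, not_false_iff,
      List.nodup_nil, and_true] at hnd
    obtain ⟨⟨hpv, hpw, hpx⟩, ⟨hvw, hvx⟩, hwx⟩ := hnd
    let s : PivotVar 1 → Fin P.n
      | .p => p
      | .v _ => v
      | .w _ => w
      | .x _ => x
    let t : PivotVar 1 → PivotVal → Fin P.d
      | .p, .a => α
      | .p, .b => β
      | .v _, _ => γ
      | .w _, _ => δ
      | .x _, _ => ε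
    have hs : Function.Injective s := by
      rintro (_ | i | i | i) (_ | j | j | j) hij <;>
        first
          | rfl
          | exact absurd hij ‹_›
          | exact absurd hij.symm ‹_›
          | rw [Subsingleton.elim i j]
    have hc (c) (hc : c ∈ (Pivot 1).constraints) :
        c = nogood .p .a (.v 0) .b ∨ c = nogood .p .a (.w 0) .b ∨ c = nogood .p .b (.x 0) .b := by
      rcases hc with ⟨i, -, hi⟩ | ⟨i, j, hij, -⟩
      · rwa [Subsingleton.elim i 0] at hi
      · omega
    refine ⟨s, t, ⟨fun y z hyz h => absurd (hs h) hyz, fun y z hyz h => hyz (hs h), ?_⟩, ?_⟩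
    · have key (y α z β)
          (l l' : (nogood (V := PivotVar 1) (D := PivotVal) y α z β).scope → PivotVal) :
          (nogood y α z β).rel l ≤ (nogood y α z β).rel l' ∨
            (nogood y α z β).rel l' ≤ (nogood y α z β).rel l := by
        simp only [nogood]
        split_ifs
        · exact Or.inl le_rfl
        · exact Or.inr (Or.inl rfl)
        · exact Or.inl (Or.inl rfl)
        · exact Or.inl le_rfl
      intro c hc' l l' _
      rcases hc c hc' with rfl | rfl | rfl <;> exact key _ _ _ _ _ _
    · intro c hc'
      rcases hc c hc' with rfl | rfl | rfl
      · exact (P.realises_nogood_iff hpv _ _).mpr h₁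
      · exact (P.realises_nogood_iff hpw _ _).mpr h₂
      · exact (P.realises_nogood_iff hpx _ _).mpr h₃

lemma fewConflicts (P : BinaryCSP) (hP : P ∈ cspForbidding (Pivot 1))
    (R : Fin P.n → Fin P.d → Fin P.n → Fin P.d → Prop) :
    FewConflicts R (fun u a v b => P.compat u a v b = true) Finset.univ := by
  intro q _
  by_contra! hq
  obtain ⟨h3, a, -, h2⟩ := hq
  obtain ⟨v, hv, w, hw, hvw⟩ := Finset.one_lt_card.mp h2
  have h1 : 0 < ((neighbours R (fun u a v b => P.compat u a v b = true) Finset.univ q) \ {v, w}).card := by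
    have := Finset.le_card_sdiff ({v, w} : Finset (Fin P.n))
      (neighbours R (fun u a v b => P.compat u a v b = true) Finset.univ q)
    have := Finset.card_le_two (a := v) (b := w)
    omega
  obtain ⟨x, hx⟩ := Finset.card_pos.mp h1
  simp only [Finset.mem_sdiff, Finset.mem_insert, Finset.mem_singleton, not_or, mem_neighbours] at hx
  obtain ⟨⟨-, hxq, β, ε, -, -, hx'⟩, hxv, hxw⟩ := hx
  obtain ⟨-, hvq, γ, -, hv'⟩ := mem_valueConflicts.mp hv
  obtain ⟨-, hwq, δ, -, hw'⟩ := mem_valueConflicts.mp hw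
  refine hP (P.pivot_one_occursIn_iff.mpr ⟨q, v, w, x, a, β, γ, δ, ε, ?_, by simpa using hv',
    by simpa using hw', by simpa using hx'⟩)
  simp [hvq.symm, hwq.symm, hxq.symm, hvw, Ne.symm hxv, Ne.symm hxw]

end BinaryCSP

/-! ### Tree width of complete graphs -/

namespace TreeDecomposition

variable {V : Type}

/-- Every tree decomposition of a complete graph has a bag that contains all vertices. -/
theorem exists_bag_eq_univ (X : TreeDecomposition (⊤ : SimpleGraph V)) :
    ∃ t, ∀ v, v ∈ X.bag t := by
  classical
  let := X.fintypeNode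
  by_contra! h
  choose m hm using h
  have hinter (u v : V) : ∃ t, u ∈ X.bag t ∧ v ∈ X.bag t := by
    by_cases huv : u = v
    · obtain ⟨t, ht⟩ := (X.connected u).nonempty
      exact ⟨t, ht, huv ▸ ht⟩
    · exact X.edge_subset u v huv
  have hstep (t : X.Node) : ∃ t', X.tree.Adj t t' ∧ ∃ z, m t ∈ X.bag z ∧
      (X.tree.deleteEdges {s(t, t')}).Reachable t' z := by
    obtain ⟨z, hz, -⟩ := hinter (m t) (m t)
    obtain ⟨w, hw⟩ := (X.isTree.connected t z).exists_isPath
    cases w with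
    | nil => exact absurd hz (hm t)
    | cons hadj w =>
      rename_i t'
      rw [SimpleGraph.Walk.cons_isPath_iff] at hw
      refine ⟨t', hadj, z, hz, ⟨w.toDeleteEdges _ fun e he h => ?_⟩⟩
      rw [Set.mem_singleton_iff] at h
      exact hw.2 (w.fst_mem_support_of_mem_edges (h ▸ he))
  choose f hf g hg hr using hstep
  have hsub (t : X.Node) (y : X.Node) (hy : m t ∈ X.bag y) :
      (X.tree.deleteEdges {s(t, f t)}).Reachable (f t) y := by
    refine (hr t).trans ?_
    have := (X.connected (m t)).preconnected ⟨g t, hg t⟩ ⟨y, hy⟩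
    let φ : X.tree.induce {y | m t ∈ X.bag y} →g X.tree.deleteEdges {s(t, f t)} :=
      ⟨Subtype.val, by
        rintro ⟨a, ha⟩ ⟨b, hb⟩ hab
        rw [SimpleGraph.deleteEdges_adj]
        refine ⟨hab, fun he => ?_⟩
        rw [Set.mem_singleton_iff, Sym2.eq_iff] at he
        rcases he with ⟨h, -⟩ | ⟨-, h⟩
        · exact hm t (h ▸ ha)
        · exact hm t (h ▸ hb)⟩
    exact this.map φ
  obtain ⟨t, t', htt, he⟩ : ∃ t t', t ≠ t' ∧ s(t, f t) = s(t', f t') := by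
    have hcard := X.isTree.card_edgeFinset
    obtain ⟨t, -, t', -, hne, he⟩ := Finset.exists_ne_map_eq_of_card_lt_of_maps_to
      (s := Finset.univ) (t := X.tree.edgeFinset) (f := fun t => s(t, f t))
      (by rw [Finset.card_univ]; omega) (fun t _ => by simpa using hf t)
    exact ⟨t, t', hne, he⟩
  rcases Sym2.eq_iff.mp he with ⟨h, -⟩ | ⟨h₁, h₂⟩
  · exact htt h
  · obtain ⟨y, hy, hy'⟩ := hinter (m t) (m t')
    have hb := SimpleGraph.isAcyclic_iff_forall_adj_isBridge.mp X.isTree.isAcyclic (hf t)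
    rw [SimpleGraph.isBridge_iff] at hb
    have h3 := hsub t' y hy'
    rw [← he, ← h₁] at h3
    exact hb (h3.trans (hsub t y hy).symm)

end TreeDecomposition

theorem le_treeWidth_top {V : Type} [Fintype V] :
    Fintype.card V - 1 ≤ treeWidth (⊤ : SimpleGraph V) := by
  have hne : (Set.range fun X : TreeDecomposition (⊤ : SimpleGraph V) => X.width).Nonempty :=
    ⟨_, ⟨{ Node := Unit
           tree := ⊥
           isTree := SimpleGraph.IsTree.of_subsingleton
           bag := fun _ => Finset.univ
           connected := fun v =>
            { preconnected := SimpleGraph.Preconnected.of_subsingleton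
              nonempty := ⟨⟨(), Finset.mem_univ v⟩⟩ }
           edge_subset := fun u v _ => ⟨(), Finset.mem_univ u, Finset.mem_univ v⟩ }, rfl⟩⟩
  obtain ⟨X, hX⟩ := Nat.sInf_mem hne
  obtain ⟨t, ht⟩ := X.exists_bag_eq_univ
  rw [treeWidth, ← hX]
  dsimp only [TreeDecomposition.width]
  let := X.fintypeNode
  have h := Finset.le_sup (f := fun t => (X.bag t).card) (Finset.mem_univ t)
  have : (X.bag t).card = Fintype.card V := by
    rw [Finset.eq_univ_iff_forall.mpr ht, Finset.card_univ]
  omega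

/-- The instance with `n` variables and `n` values in which the only pair disallowed between `u`
and `v` is the assignment of `v` to `u` and of `u` to `v`. -/
def mutualInstance (n : ℕ) : BinaryCSP where
  n := n
  d := n
  unary _ _ := true
  binary u v _ a b := !(decide (a = v) && decide (b = u))

lemma mutualInstance_compat {n : ℕ} {u v : Fin (mutualInstance n).n} (huv : u ≠ v)
    {a b : Fin (mutualInstance n).d} (h : (mutualInstance n).compat u a v b = false) :
    (a : ℕ) = v := by
  rcases lt_or_gt_of_ne huv with hlt | hlt
  · rw [BinaryCSP.compat_of_lt _ hlt] at h
    simp only [mutualInstance, Bool.not_eq_false', Bool.and_eq_true, decide_eq_true_eq] at h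
    exact congrArg Fin.val h.1
  · rw [BinaryCSP.compat_comm, BinaryCSP.compat_of_lt _ hlt] at h
    simp only [mutualInstance, Bool.not_eq_false', Bool.and_eq_true, decide_eq_true_eq] at h
    exact congrArg Fin.val h.2

lemma mutualInstance_mem (n : ℕ) : mutualInstance n ∈ cspForbidding (Pivot 1) := by
  intro h
  obtain ⟨p, v, w, x, α, β, γ, δ, ε, hnd, h₁, h₂, -⟩ :=
    (mutualInstance n).pivot_one_occursIn_iff.mp h
  simp only [List.nodup_cons, List.mem_cons, List.not_mem_nil, or_false, not_or] at hnd
  have hv := mutualInstance_compat hnd.1.1 h₁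
  have hw := mutualInstance_compat hnd.1.2.1 h₂
  exact hnd.2.1.1 (Fin.ext (hv.symm.trans hw))

lemma mutualInstance_constraintGraph (n : ℕ) :
    (mutualInstance n).toPattern.constraintGraph = ⊤ := by
  have key {u v : Fin n} (h : u < v) : (mutualInstance n).toPattern.constraintGraph.Adj u v := by
    refine ⟨h.ne, _, Or.inr ⟨u, v, h, rfl⟩, rfl, fun z => if z.1.val = u.val then v else u, ?_⟩
    simp [BinaryCSP.binaryConstraint, mutualInstance, TV.ofBool, Fin.val_inj, h.ne']
  rw [eq_top_iff]
  intro u v huv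
  rcases lt_or_gt_of_ne huv.ne with h | h
  · exact key h
  · exact (key h).symm

theorem exists_lt_treeWidth (k : ℕ) :
    ∃ P ∈ cspForbidding (Pivot 1), k < treeWidth P.toPattern.constraintGraph := by
  refine ⟨mutualInstance (k + 2), mutualInstance_mem _, ?_⟩
  rw [mutualInstance_constraintGraph]
  have := le_treeWidth_top (V := Fin (mutualInstance (k + 2)).n)
  rw [Fintype.card_fin] at this
  exact lt_of_lt_of_le (Nat.lt_succ_self k) this

/-! ### The main theorem -/

lemma flatMap_finRange {α : Type} {n : ℕ} {f : Fin n → List α} {g : ℕ → List α}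
    (h : ∀ i, f i = g i) : (List.finRange n).flatMap f = (List.range n).flatMap g := by
  rw [← List.map_coe_finRange_eq_range, List.flatMap_map]
  congr 1
  exact funext h

lemma flatMap_range_lt {α : Type} (G : ℕ → List α) {n u : ℕ} (hu : u < n) :
    ((List.range n).flatMap fun v => if u < v then G v else []) =
      (List.range (n - u - 1)).flatMap fun k => G (u + 1 + k) := by
  obtain ⟨m, rfl⟩ := Nat.exists_eq_add_of_lt hu
  rw [show u + m + 1 = (u + 1) + m by omega, List.range_add, List.flatMap_append,
    List.flatMap_map, show u + 1 + m - u - 1 = m by omega, List.flatMap_eq_nil_iff.mpr]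
  · simp [show ∀ x, u < u + 1 + x by omega]
  · intro v hv
    rw [List.mem_range] at hv
    rw [if_neg (by omega)]

namespace BinaryCSP

/-- Compatibility of assignments, for variables and values given by their numbers. -/
def compatNat (P : BinaryCSP) (u a v b : ℕ) : Bool :=
  if h : (u < P.n ∧ a < P.d) ∧ v < P.n ∧ b < P.d then
    P.compat ⟨u, h.1.1⟩ ⟨a, h.1.2⟩ ⟨v, h.2.1⟩ ⟨b, h.2.2⟩
  else false

lemma compatNat_val (P : BinaryCSP) (u : Fin P.n) (a : Fin P.d) (v : Fin P.n) (b : Fin P.d) :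
    P.compatNat u a v b = P.compat u a v b := by
  simp [compatNat]

lemma compatNat_comm (P : BinaryCSP) (u a v b : ℕ) :
    P.compatNat u a v b = P.compatNat v b u a := by
  unfold compatNat
  by_cases h : (u < P.n ∧ a < P.d) ∧ v < P.n ∧ b < P.d
  · rw [dif_pos h, dif_pos h.symm, compat_comm]
  · rw [dif_neg h, dif_neg fun h' => h h'.symm]

lemma eq_of_compatNat_self (P : BinaryCSP) {u a b : ℕ} (h : P.compatNat u a u b = true) :
    a = b := by
  unfold compatNat at h
  split_ifs at h
  rw [compat_self, Bool.and_eq_true, decide_eq_true_eq] at h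
  exact congrArg Fin.val h.1

lemma encode_eq (P : BinaryCSP) :
    P.encode = rep P.n ++ false :: (rep P.d ++ false ::
      (unaryBits P.n P.d P.compatNat ++ binaryBits P.n P.d P.compatNat)) := by
  have h₁ : ((List.finRange P.n).flatMap fun v => (List.finRange P.d).map fun a => P.unary v a) =
      unaryBits P.n P.d P.compatNat := by
    refine flatMap_finRange fun v => ?_
    rw [List.map_eq_flatMap]
    refine flatMap_finRange fun a => ?_
    rw [compatNat_val, compat_self]
    simp
  have h₂ : ((List.finRange P.n).flatMap fun u => (List.finRange P.n).flatMap fun v =>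
      if h : u < v then
        (List.finRange P.d).flatMap fun a => (List.finRange P.d).map fun b => P.binary u v h a b
      else []) = binaryBits P.n P.d P.compatNat := by
    refine flatMap_finRange fun u => ?_
    rw [← flatMap_range_lt (fun v => (List.range P.d).flatMap fun a =>
      (List.range P.d).flatMap fun b => [P.compatNat u a v b]) u.2]
    refine flatMap_finRange fun v => ?_
    by_cases h : u < v
    · rw [dif_pos h, if_pos (Fin.lt_def.mp h)]
      refine flatMap_finRange fun a => ?_
      rw [List.map_eq_flatMap]
      refine flatMap_finRange fun b => ?_
      rw [compatNat_val, compat_of_lt P h]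
    · rw [dif_neg h, if_neg fun h' => h (Fin.lt_def.mpr h')]
  unfold encode
  rw [h₁, h₂]
  simp [rep]

variable {P : BinaryCSP} {T₀ T : List Bool}

lemma isSolution_of_sol
    (hT₀ : ∀ u < P.n, ∀ a < P.d, ∀ v < P.n, ∀ b < P.d,
      entryAt P.n P.d T₀ u a v b = P.compatNat u a v b)
    {s : ℕ → ℕ} (hs : Sol P.n P.d T₀ s) :
    P.toPattern.IsSolution fun v => ⟨s v, hs.1 v v.2⟩ := by
  rw [isSolution_iff]
  intro u v
  rw [← compatNat_val, ← hT₀ u u.2 _ (hs.1 u u.2) v v.2 _ (hs.1 v v.2)]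
  exact hs.2 u u.2 v v.2

lemma exists_sol_of_isSolution
    (hT₀ : ∀ u < P.n, ∀ a < P.d, ∀ v < P.n, ∀ b < P.d,
      entryAt P.n P.d T₀ u a v b = P.compatNat u a v b)
    {s : Fin P.n → Fin P.d} (hs : P.toPattern.IsSolution s) :
    ∃ s' : ℕ → ℕ, Sol P.n P.d T₀ s' ∧ ∀ v : Fin P.n, s' v = s v := by
  rw [isSolution_iff] at hs
  have hval (u : ℕ) (hu : u < P.n) : (if h : u < P.n then (s ⟨u, h⟩ : ℕ) else 0) = s ⟨u, hu⟩ :=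
    dif_pos hu
  refine ⟨fun u => if h : u < P.n then s ⟨u, h⟩ else 0, ⟨fun u hu => ?_, fun u hu v hv => ?_⟩,
    fun v => hval v v.2⟩
  · dsimp only
    rw [hval u hu]
    exact (s ⟨u, hu⟩).2
  · dsimp only
    rw [hval u hu, hval v hv, hT₀ u hu _ (s _).2 v hv _ (s _).2]
    exact (P.compatNat_val ⟨u, hu⟩ _ ⟨v, hv⟩ _).trans (hs _ _)

/-- In the absence of the pivot pattern, the table of a search contains a solution. -/
lemma exists_sol_of_searchInv (hP : P ∈ cspForbidding (Pivot 1))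
    (hT₀ : ∀ u < P.n, ∀ a < P.d, ∀ v < P.n, ∀ b < P.d,
      entryAt P.n P.d T₀ u a v b = P.compatNat u a v b)
    (h : SearchInv P.n P.d T₀ T) :
    ∃ s, Sol P.n P.d T₀ s ∧ ∀ u < P.n, entryAt P.n P.d T u (s u) u (s u) = true := by
  have hval := h.hasValues
  simp only [hasValues, List.all_eq_true, List.any_eq_true, List.mem_range] at hval
  rcases Nat.eq_zero_or_pos P.n with hn | hn
  · exact ⟨fun _ => 0, ⟨fun u hu => by omega, fun u hu => by omega⟩, fun u hu => by omega⟩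
  obtain ⟨a₀, ha₀, -⟩ := hval 0 hn
  have : Nonempty (Fin P.d) := ⟨⟨a₀, ha₀⟩⟩
  have hR (u : Fin P.n) (a : Fin P.d) (v : Fin P.n) (b : Fin P.d)
      (hT : entryAt P.n P.d T u a v b = true) : P.compat u a v b = true := by
    rw [← compatNat_val, ← hT₀ u u.2 a a.2 v v.2 b b.2]
    exact h.sub _ hT
  obtain ⟨s, hs₁, hs₂⟩ := exists_solution_of_fewConflicts
    (fun (u : Fin P.n) (a : Fin P.d) (v : Fin P.n) (b : Fin P.d) =>
      entryAt P.n P.d T u a v b = true) Finset.univ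
    (fun u a b hab => Fin.ext (P.eq_of_compatNat_self ((P.compatNat_val _ _ _ _).trans
      (hR u a u b hab))))
    (fun u _ a v _ b hab w _ => by
      obtain ⟨c, hc, hc'⟩ := h.closed u u.2 a a.2 v v.2 b b.2 w w.2 hab
      exact ⟨⟨c, hc⟩, hc'⟩)
    (fun w _ => by
      obtain ⟨c, hc, hc'⟩ := hval w w.2
      exact ⟨⟨c, hc⟩, hc'⟩)
    Finset.univ (fun u a v b => P.compat u a v b = true) (Finset.Subset.refl _)
    (fun u a v b hab => by rwa [compat_comm] at hab)
    (fun u _ a v _ b _ hab => hR u a v b hab) (P.fewConflicts hP _)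
  have hsol : P.toPattern.IsSolution s := by
    rw [isSolution_iff]
    intro u v
    by_cases huv : u = v
    · subst huv
      exact hR _ _ _ _ (hs₁ u (Finset.mem_univ u))
    · exact hs₂ u (Finset.mem_univ u) v (Finset.mem_univ v) huv
  obtain ⟨s', hs', hv⟩ := exists_sol_of_isSolution hT₀ hsol
  refine ⟨s', hs', fun u hu => ?_⟩
  rw [hv ⟨u, hu⟩]
  exact hs₁ ⟨u, hu⟩ (Finset.mem_univ _)

lemma sizeBound {n d L : ℕ} (h : n + 1 + (d + 1) ≤ L) : SizeBound n d ((L + 1) ^ 4) := by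
  have hn : n ≤ L + 1 := by omega
  have hd : d ≤ L + 1 := by omega
  have h1 : 1 ≤ L + 1 := by omega
  have p1 : L + 1 ≤ (L + 1) ^ 4 := Nat.le_self_pow (by omega) _
  have p2 : (L + 1) * (L + 1) ≤ (L + 1) ^ 4 := by
    rw [← pow_two]; exact Nat.pow_le_pow_right h1 (by omega)
  have p3 : (L + 1) * (L + 1) * (L + 1) ≤ (L + 1) ^ 4 := by
    rw [← pow_three']; exact Nat.pow_le_pow_right h1 (by omega)
  have p4 : (L + 1) * (L + 1) * (L + 1) * (L + 1) ≤ (L + 1) ^ 4 := by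
    rw [← pow_three', ← pow_succ]
  exact
    { n_le := hn.trans p1
      d_le := hd.trans p1
      one := h1.trans p1
      nd := (Nat.mul_le_mul hn hd).trans p2
      ndn := (Nat.mul_le_mul (Nat.mul_le_mul hn hd) hn).trans p3
      ndnd := (Nat.mul_le_mul (Nat.mul_le_mul (Nat.mul_le_mul hn hd) hn) hd).trans p4 }

/-- The program finds a solution of an instance without the pivot pattern, or reports that there
is none. -/
theorem exists_answer (P : BinaryCSP) (hP : P ∈ cspForbidding (Pivot 1)) :
    ∃ o : Option (List ℕ),
      ((∀ l, o = some l → ∃ s, P.toPattern.IsSolution s ∧ l = List.ofFn fun v => (s v : ℕ)) ∧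
        (o = none → ¬ ∃ s, P.toPattern.IsSolution s)) ∧
      StackProg.Runs ((P.encode.length + 1) ^ 4) TableProg.solveProg
        (Function.update (fun _ => []) .inp P.encode)
        (Function.update (fun _ => []) .out (encodeAnswer o)) := by
  obtain ⟨T₀, hread, hT₀⟩ := readBinary_readUnary P.n P.d P.compatNat P.compatNat_comm
    fun _ _ _ => P.eq_of_compatNat_self
  have hlen : P.n + 1 + (P.d + 1 + (unaryBits P.n P.d P.compatNat ++
      binaryBits P.n P.d P.compatNat).length) = P.encode.length := by
    rw [encode_eq]
    simp [rep]
    omega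
  have hB : SizeBound P.n P.d ((P.encode.length + 1) ^ 4) := sizeBound (by omega)
  have hL : P.encode.length + 1 ≤ (P.encode.length + 1) ^ 4 := Nat.le_self_pow (by omega) _
  have hout : (writeValues P.n P.d (searchTable P.n P.d (closure3 P.n P.d T₀)) [true]).length ≤
      (P.encode.length + 1) ^ 4 := by
    refine (length_writeValues_le _ _ _ _).trans ?_
    set L := P.encode.length
    have h3 : P.n * (P.d * P.d) ≤ L * (L * L) :=
      Nat.mul_le_mul (by omega) (Nat.mul_le_mul (by omega) (by omega))
    have : 1 + L * (L * L) ≤ (L + 1) ^ 4 :=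
      calc 1 + L * (L * L) ≤ (L + 1) ^ 3 := by ring_nf; omega
        _ ≤ (L + 1) ^ 4 := Nat.pow_le_pow_right (by omega) (by omega)
    simp only [List.length_singleton]
    omega
  have hrun := TableProg.runs_solveProg hB (by omega) hread hout
  rw [← encode_eq] at hrun
  by_cases hv : hasValues P.n P.d (closure3 P.n P.d T₀) = true
  · obtain ⟨s, hs, hs'⟩ := searchTable_spec (SearchInv.closure3 hv)
      fun T hT => exists_sol_of_searchInv hP hT₀ hT
    refine ⟨some (List.ofFn fun v : Fin P.n => s v), ⟨?_, by simp⟩, ?_⟩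
    · rintro l hl
      exact ⟨_, isSolution_of_sol hT₀ hs, (Option.some.inj hl).symm⟩
    · rw [if_pos hv] at hrun
      convert hrun using 2
      rw [writeValues, writeValues_eq hs.1 hs', List.reverse_append, List.reverse_reverse,
        encodeAnswer, List.ofFn_eq_map, List.flatMap_map]
      exact congrArg (true :: ·) (flatMap_finRange fun v => rfl)
  · refine ⟨none, ⟨by simp, ?_⟩, ?_⟩
    · rintro - ⟨s, hs⟩
      obtain ⟨s', hs', -⟩ := exists_sol_of_isSolution hT₀ hs
      exact hv hs'.closure3.hasValues
    · rw [if_neg hv] at hrun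
      exact hrun

end BinaryCSP

theorem solvableInPolyTime_pivot_one : SolvableInPolyTime (cspForbidding (Pivot 1)) := by
  choose solve hsolve hrun using fun P : cspForbidding (Pivot 1) => P.1.exists_answer P.2
  refine ⟨solve, StackProg.nonempty_computable TableProg.solveProg .inp .out _ _ _
    ((Polynomial.X + 1) ^ 4) fun P => ?_, hsolve⟩
  simpa using hrun P

theorem mainTheorem5 :
    SolvableInPolyTime (cspForbidding (Pivot 1)) ∧
      ∀ k : ℕ, ∃ P ∈ cspForbidding (Pivot 1), k < treeWidth P.toPattern.constraintGraph :=
  ⟨solvableInPolyTime_pivot_one, exists_lt_treeWidth⟩
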